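/- Let $0<c_m\le c_M<\infty$. For $n\ge 1$ let $p=p_n\ge 1$ be an integer and let $\tilde X_n$ be a random $n\times p_n$ real matrix whose rows are i.i.d. $\mathcal N(0,\tilde\Sigma_n)$, where the $p_n\times p_n$ covariance matrices satisfy $c_m\le\inf_{n}\lambda_{\min}(\tilde\Sigma_n)\le\sup_{n}\lambda_{\max}(\tilde\Sigma_n)\le c_M$. For a real $n\times p$ matrix $A$ let $s_{\max}(A)$ be its largest singular value, $s_{\min}(A)$ its $\min(n,p)$-th singular value in descending order, and $\kappa(A)=s_{\max}(A)/s_{\min}(A)$ (moments of $\kappa$ take values in $[0,\infty]$). (i) (Wide-matrix regime) Suppose $p_n/n\to\gamma\in(1,\infty)$, and let $r\ge 0$. Then there is a constant $K(r)>0$, depending only on $r,\gamma,c_m,c_M$, such that $\mathbb E[\kappa(\tilde X_n)^r]\le K(r)$ for all sufficiently large $n$. Moreover, there is a constant $K'(r)>0$, depending only on $r,\gamma,c_m,c_M$ and the sequence $(p_n)$, such that $\mathbb E[\kappa(\tilde X_n)^r]\le K'(r)$ for all $n\ge 1$ with $r<|p_n-n|+1$ (a condition that holds for all sufficiently large $n$).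 (ii) (Critical regime) If $p_n/n\to 1$, then for every $r>0$, $\mathbb E[\kappa(\tilde X_n)^r]\to\infty$ as $n\to\infty$. -/

import Mathlib

open MeasureTheory ProbabilityTheory Filter Topology
open scoped ENNReal

noncomputable section

/-- The `k`-th singular value (counted from `0`, in descending order, with multiplicity) of a
real `n × p` matrix, that is, of the linear map `ℝᵖ → ℝⁿ` between Euclidean spaces it defines. -/
def matSingularValue {n p : ℕ} (A : Matrix (Fin n) (Fin p) ℝ) (k : ℕ) : ℝ :=
  (Matrix.toEuclideanLin A).singularValues k

/-- The largest singular value. -/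
def sMax {n p : ℕ} (A : Matrix (Fin n) (Fin p) ℝ) : ℝ :=
  matSingularValue A 0

/-- The `min(n,p)`-th singular value in descending order. -/
def sMin {n p : ℕ} (A : Matrix (Fin n) (Fin p) ℝ) : ℝ :=
  matSingularValue A (min n p - 1)

/-- The condition number `sMax A / sMin A`, as an extended nonnegative real: it is `∞` when
`A ≠ 0` does not have full rank `min(n,p)`. -/
def condNumber {n p : ℕ} (A : Matrix (Fin n) (Fin p) ℝ) : ℝ≥0∞ :=
  ENNReal.ofReal (sMax A) / ENNReal.ofReal (sMin A)

/-- `S` is symmetric, with smallest eigenvalue at least `a` and largest eigenvalue at most `b`. -/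
def EigenvaluesBetween (a b : ℝ) {p : ℕ} (S : Matrix (Fin p) (Fin p) ℝ) : Prop :=
  ∃ h : S.IsHermitian, ∀ i, a ≤ h.eigenvalues i ∧ h.eigenvalues i ≤ b

/-- The rows of the random `n × p` matrix `X` are independent and each of them is distributed as
`𝒩(0, S)`. -/
structure HasIIDGaussianRows {Ω : Type*} [MeasurableSpace Ω] {n p : ℕ}
    (X : Ω → Matrix (Fin n) (Fin p) ℝ) (S : Matrix (Fin p) (Fin p) ℝ) (P : Measure Ω) :
    Prop where
  indep : iIndepFun (fun (i : Fin n) (ω : Ω) => WithLp.toLp 2 (X ω i)) P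
  law : ∀ i : Fin n,
    HasLaw (fun ω : Ω => WithLp.toLp 2 (X ω i)) (multivariateGaussian 0 S) P

/-- The `r`-th moment `𝔼[κ(X)^r] ∈ [0, ∞]` of the condition number of a random matrix. -/
def condMoment {Ω : Type*} [MeasurableSpace Ω] {n p : ℕ}
    (X : Ω → Matrix (Fin n) (Fin p) ℝ) (P : Measure Ω) (r : ℝ) : ℝ≥0∞ :=
  ∫⁻ ω, condNumber (X ω) ^ r ∂P

/-- The random matrices `X n` (`n = 1, 2, …`), of size `n × p n` and defined on probability spaces
`(Ω n, P n)`, have i.i.d. rows with law `𝒩(0, S n)`, where the covariance matrices `S n` have all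
their eigenvalues in `[a, b]`, uniformly in `n`. -/
structure IsGaussianDesign (a b : ℝ) (p : ℕ → ℕ) {Ω : ℕ → Type*} [∀ n, MeasurableSpace (Ω n)]
    (P : ∀ n, Measure (Ω n)) (S : ∀ n, Matrix (Fin (p n)) (Fin (p n)) ℝ)
    (X : ∀ n, Ω n → Matrix (Fin n) (Fin (p n)) ℝ) : Prop where
  isProbabilityMeasure : ∀ n, 1 ≤ n → IsProbabilityMeasure (P n)
  eigenvalues : ∀ n, 1 ≤ n → EigenvaluesBetween a b (S n)
  rows : ∀ n, 1 ≤ n → HasIIDGaussianRows (X n) (S n) (P n)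

end

/-!
Both regimes are proved for a standard Gaussian matrix `Z`, of size `m × d` with `d ≤ m`. A design
with covariance `S` has the law of `Z √S`, and multiplication by `√S` changes the condition number
by a factor of at most `√(c_M / c_m)` in either direction (`condNumber_mul_le`,
`condNumber_le_mul`). Transposition preserves both the law of `Z` and the condition number, so
that one may take `m = max n p` and `d = min n p`.

*Upper bound.* Write `s ≤ L` for the extreme singular values of `Z`. If `u` is a unit vector with
`‖Z u‖ = s`, then `‖Z v‖ ≤ 2 s` on an ellipsoid around `u` that has one axis of order one and
`d - 1` axes of order `s / L` (`volume_contracted_ge`). Hence the integral of `‖Z v‖ ^ (-a)` over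
the shell `1 / 2 ≤ ‖v‖ ≤ 3 / 2` is at least `c s ^ (-a) (s / L) ^ (d - 1)`. By Tonelli's theorem the
expectation of the integral is at most the volume of the shell times the largest `-a`-th moment
of `‖Z v‖`, which the Laplace transform of `‖Z v‖²` bounds for every `a < m`
(`lintegral_rpow_sqrt_div_norm_le`, `lintegral_rpow_mul_pow_le`). The same averaging bounds
`𝔼 exp(L² / 36)` by `6 ^ m` (`lintegral_exp_sMax_sq_le`), hence all moments of `L / √m`.
Since `(L / s) ^ r` is a geometric mean of `s ^ (-a) (s / L) ^ (d - 1)` and of a power of `L`,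
with a weight `θ = r / (a - d + 1)` on the former (`rpow_le_interpolation`), its expectation is
finite as soon as `r < a - d + 1`, and `a` may be any number below `m`: this is the full range
`r < m - d + 1`. If `m / (m - d + 1)` is bounded, take `a` halfway between `d - 1` and `m`. The
bounds on expectations are exponential in `m` but enter to the power `θ`, which is of order
`1 / m`, so the result is uniform.

*Lower bound.* Testing `Z` on a unit vector orthogonal to its first `d - 1` rows gives
`𝔼 s² ≤ m - d + 1` (`lintegral_sMin_sq_le`), which is `o(m)` if `p / n → 1`, while `L` is at least
`√m / 8` up to a probability `2 ^ (-m)`. So `L / s` tends to infinity in probability.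
-/

/-! ### Extremal characterisation of the singular values -/

section Extremal

open Module InnerProductSpace

variable {E F : Type*} [NormedAddCommGroup E] [InnerProductSpace ℝ E] [FiniteDimensional ℝ E]
  [NormedAddCommGroup F] [InnerProductSpace ℝ F] [FiniteDimensional ℝ F]

/-- A right singular basis of `T`, with the expansion of `‖T v‖²` in it. -/
theorem LinearMap.exists_orthonormalBasis_singularValues (T : E →ₗ[ℝ] F) {d : ℕ}
    (hd : finrank ℝ E = d) :
    ∃ b : OrthonormalBasis (Fin d) ℝ E,
      (∀ i, T.adjoint (T (b i)) = (T.singularValues i ^ 2) • b i) ∧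
      (∀ v, ‖T v‖ ^ 2 = ∑ i : Fin d, T.singularValues i ^ 2 * inner ℝ (b i) v ^ 2) := by
  have hT := T.isSymmetric_adjoint_comp_self
  refine ⟨hT.eigenvectorBasis hd, fun i => ?_, fun v => ?_⟩
  · rw [T.sq_singularValues_fin hd]
    exact hT.apply_eigenvectorBasis hd i
  · have h1 : ‖T v‖ ^ 2 = inner ℝ ((T.adjoint ∘ₗ T) v) v := by
      rw [LinearMap.comp_apply, LinearMap.adjoint_inner_left, real_inner_self_eq_norm_sq]
    rw [h1, ← (hT.eigenvectorBasis hd).sum_inner_mul_inner]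
    refine Finset.sum_congr rfl fun i _ => ?_
    have h2 : inner ℝ ((T.adjoint ∘ₗ T) v) (hT.eigenvectorBasis hd i)
        = T.singularValues i ^ 2 * inner ℝ (hT.eigenvectorBasis hd i) v := by
      rw [hT v, hT.apply_eigenvectorBasis hd i, inner_smul_right, T.sq_singularValues_fin hd,
        real_inner_comm]
      rfl
    rw [h2]; ring

theorem LinearMap.singularValues_last_mul_norm_le (T : E →ₗ[ℝ] F) (v : E) :
    T.singularValues (finrank ℝ E - 1) * ‖v‖ ≤ ‖T v‖ := by
  obtain ⟨b, -, hb⟩ := T.exists_orthonormalBasis_singularValues rfl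
  refine le_of_sq_le_sq ?_ (norm_nonneg _)
  rw [hb, mul_pow, ← b.sum_sq_inner_right, Finset.mul_sum]
  refine Finset.sum_le_sum fun i _ => mul_le_mul_of_nonneg_right ?_ (sq_nonneg _)
  exact pow_le_pow_left₀ (T.singularValues_nonneg _) (T.singularValues_antitone (by omega)) 2

theorem LinearMap.norm_le_singularValues_zero_mul (T : E →ₗ[ℝ] F) (v : E) :
    ‖T v‖ ≤ T.singularValues 0 * ‖v‖ := by
  obtain ⟨b, -, hb⟩ := T.exists_orthonormalBasis_singularValues rfl
  refine le_of_sq_le_sq ?_ (mul_nonneg (T.singularValues_nonneg _) (norm_nonneg _))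
  rw [hb, mul_pow, ← b.sum_sq_inner_right, Finset.mul_sum]
  refine Finset.sum_le_sum fun i _ => mul_le_mul_of_nonneg_right ?_ (sq_nonneg _)
  exact pow_le_pow_left₀ (T.singularValues_nonneg _) (T.singularValues_antitone (by omega)) 2

theorem LinearMap.exists_norm_eq_singularValues (T : E →ₗ[ℝ] F) {k : ℕ} (hk : k < finrank ℝ E) :
    ∃ v, ‖v‖ = 1 ∧ ‖T v‖ = T.singularValues k := by
  obtain ⟨b, hb, -⟩ := T.exists_orthonormalBasis_singularValues rfl
  refine ⟨b ⟨k, hk⟩, b.norm_eq_one _, ?_⟩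
  have h1 : ‖T (b ⟨k, hk⟩)‖ ^ 2 = T.singularValues k ^ 2 := by
    rw [← real_inner_self_eq_norm_sq, ← LinearMap.adjoint_inner_left, hb, real_inner_smul_left,
      real_inner_self_eq_norm_sq, b.norm_eq_one]
    simp
  exact (sq_eq_sq₀ (norm_nonneg _) (T.singularValues_nonneg _)).1 h1

/-- If `E` has at least the dimension of `F`, the singular value of `T : E → F` numbered
`dim F - 1` is the last singular value of the adjoint. -/
theorem LinearMap.singularValues_adjoint_last (T : E →ₗ[ℝ] F) (hF : 0 < finrank ℝ F)
    (hFE : finrank ℝ F ≤ finrank ℝ E) :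
    T.adjoint.singularValues (finrank ℝ F - 1) = T.singularValues (finrank ℝ F - 1) := by
  set k := finrank ℝ F - 1 with hk
  obtain ⟨b, hb, -⟩ := T.exists_orthonormalBasis_singularValues rfl
  obtain ⟨u, hu1, hu2⟩ := T.adjoint.exists_norm_eq_singularValues (k := k) (by omega)
  rcases (T.singularValues_nonneg k).eq_or_lt' with h0 | hpos
  · rw [h0]
    rw [LinearMap.singularValues_eq_zero_iff_le_finrank_range] at h0 ⊢
    rwa [LinearMap.finrank_range_adjoint]
  have hσ : ∀ i : Fin (finrank ℝ F), T.singularValues k ≤ T.singularValues i := fun i =>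
    T.singularValues_antitone (by omega)
  have hσpos : ∀ i : Fin (finrank ℝ F), 0 < T.singularValues i := fun i => hpos.trans_le (hσ i)
  let e : Fin (finrank ℝ F) → E := fun i => b (Fin.castLE hFE i)
  have he : ∀ i, T.adjoint (T (e i)) = (T.singularValues i ^ 2) • e i := fun i => hb _
  have hon : Orthonormal ℝ e := b.orthonormal.comp _ (Fin.castLE_injective hFE)
  apply le_antisymm
  · -- test the adjoint on the image of the `k`-th right singular vector
    have h := T.adjoint.singularValues_last_mul_norm_le (T (e ⟨k, by omega⟩))
    have hTe : ‖T (e ⟨k, by omega⟩)‖ = T.singularValues k := by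
      have h1 : ‖T (e ⟨k, by omega⟩)‖ ^ 2 = T.singularValues k ^ 2 := by
        rw [← real_inner_self_eq_norm_sq, ← LinearMap.adjoint_inner_left, he, real_inner_smul_left,
          real_inner_self_eq_norm_sq, hon.1]
        simp
      exact (sq_eq_sq₀ (norm_nonneg _) (T.singularValues_nonneg _)).1 h1
    rw [he, hTe, norm_smul, hon.1] at h
    simp only [Real.norm_eq_abs, abs_pow, abs_of_pos hpos, mul_one] at h
    rw [sq] at h
    exact le_of_mul_le_mul_right h hpos
  · -- the normalised images of the right singular vectors are an orthonormal basis of `F`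
    let f : Fin (finrank ℝ F) → F := fun i => (T.singularValues i)⁻¹ • T (e i)
    have hf : Orthonormal ℝ f := by
      rw [orthonormal_iff_ite]
      intro i j
      have := orthonormal_iff_ite.1 hon i j
      simp only [f, real_inner_smul_left, real_inner_smul_right]
      rw [← LinearMap.adjoint_inner_left, he, real_inner_smul_left, this]
      split_ifs with hij
      · subst hij
        have := (hσpos i).ne'
        field_simp
      · simp
    let B : OrthonormalBasis (Fin (finrank ℝ F)) ℝ F :=
      OrthonormalBasis.mk hf (by
        rw [hf.linearIndependent.span_eq_top_of_card_eq_finrank' (by simp)])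
    have hB : ∀ i, B i = f i := fun i => by simp [B]
    rw [← hu2]
    refine le_of_sq_le_sq ?_ (norm_nonneg _)
    have hbes := hon.sum_inner_products_le (x := T.adjoint u) (s := Finset.univ)
    refine le_trans ?_ hbes
    have hP := B.sum_sq_inner_right u
    rw [hu1] at hP
    calc T.singularValues k ^ 2 = ∑ i, T.singularValues k ^ 2 * inner ℝ (B i) u ^ 2 := by
          rw [← Finset.mul_sum, hP]; simp
      _ ≤ _ := by
          refine Finset.sum_le_sum fun i _ => ?_
          rw [LinearMap.adjoint_inner_right, hB]
          simp only [f, real_inner_smul_left, Real.norm_eq_abs, sq_abs]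
          rw [mul_pow, ← mul_assoc, inv_pow]
          refine mul_le_of_le_one_left (sq_nonneg _) ?_
          rw [← div_eq_mul_inv]
          have := hσpos i
          exact div_le_one_of_le₀ (pow_le_pow_left₀ hpos.le (hσ i) 2) (by positivity)

end Extremal

/-! ### Extreme singular values of matrices -/

theorem toEuclideanLin_transpose_eq_adjoint {n p : ℕ} (A : Matrix (Fin n) (Fin p) ℝ) :
    Matrix.toEuclideanLin A.transpose = (Matrix.toEuclideanLin A).adjoint := by
  rw [← Matrix.toEuclideanLin_conjTranspose_eq_adjoint, Matrix.conjTranspose_eq_transpose_of_trivial]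

theorem toEuclideanLin_mul_apply {n p q : ℕ} (A : Matrix (Fin n) (Fin p) ℝ)
    (B : Matrix (Fin p) (Fin q) ℝ) (v : EuclideanSpace ℝ (Fin q)) :
    Matrix.toEuclideanLin (A * B) v = Matrix.toEuclideanLin A (Matrix.toEuclideanLin B v) := by
  simp [Matrix.toLpLin_apply, Matrix.mulVec_mulVec]

theorem sMin_nonneg {n p : ℕ} (A : Matrix (Fin n) (Fin p) ℝ) : 0 ≤ sMin A :=
  LinearMap.singularValues_nonneg _ _

theorem sMax_nonneg {n p : ℕ} (A : Matrix (Fin n) (Fin p) ℝ) : 0 ≤ sMax A :=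
  LinearMap.singularValues_nonneg _ _

theorem sMin_mul_norm_le {m d : ℕ} (hdm : d ≤ m) (A : Matrix (Fin m) (Fin d) ℝ)
    (v : EuclideanSpace ℝ (Fin d)) : sMin A * ‖v‖ ≤ ‖Matrix.toEuclideanLin A v‖ := by
  have h := (Matrix.toEuclideanLin A).singularValues_last_mul_norm_le v
  rw [finrank_euclideanSpace_fin] at h
  rwa [sMin, min_eq_right hdm]

theorem exists_norm_eq_sMin {m d : ℕ} (hd : 1 ≤ d) (hdm : d ≤ m) (A : Matrix (Fin m) (Fin d) ℝ) :
    ∃ v : EuclideanSpace ℝ (Fin d), ‖v‖ = 1 ∧ ‖Matrix.toEuclideanLin A v‖ = sMin A := by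
  rw [sMin, min_eq_right hdm]
  exact (Matrix.toEuclideanLin A).exists_norm_eq_singularValues
    (by rw [finrank_euclideanSpace_fin]; omega)

theorem norm_le_sMax_mul {n p : ℕ} (A : Matrix (Fin n) (Fin p) ℝ) (v : EuclideanSpace ℝ (Fin p)) :
    ‖Matrix.toEuclideanLin A v‖ ≤ sMax A * ‖v‖ :=
  (Matrix.toEuclideanLin A).norm_le_singularValues_zero_mul v

theorem exists_norm_eq_sMax {n p : ℕ} (hp : 1 ≤ p) (A : Matrix (Fin n) (Fin p) ℝ) :
    ∃ v : EuclideanSpace ℝ (Fin p), ‖v‖ = 1 ∧ ‖Matrix.toEuclideanLin A v‖ = sMax A :=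
  (Matrix.toEuclideanLin A).exists_norm_eq_singularValues
    (by rw [finrank_euclideanSpace_fin]; omega)

/-- With `sMin_mul_norm_le` and `exists_norm_eq_sMin`, which concern tall matrices, this describes
`sMin` for all shapes. -/
theorem sMin_transpose {n p : ℕ} (hn : 1 ≤ n) (hp : 1 ≤ p) (A : Matrix (Fin n) (Fin p) ℝ) :
    sMin A.transpose = sMin A := by
  have key : ∀ {n p : ℕ} (A : Matrix (Fin n) (Fin p) ℝ), 1 ≤ n → n ≤ p →
      sMin A.transpose = sMin A := by
    intro n p A hn hnp
    have h := (Matrix.toEuclideanLin A).singularValues_adjoint_last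
      (by rw [finrank_euclideanSpace_fin]; omega) (by simpa using hnp)
    rw [finrank_euclideanSpace_fin, ← toEuclideanLin_transpose_eq_adjoint] at h
    rw [sMin, sMin, min_eq_left hnp, min_eq_right hnp]
    exact h
  rcases le_total n p with h | h
  · exact key A hn h
  · simpa using (key A.transpose hp h).symm

theorem sMax_le_of_forall_norm_le {n p : ℕ} (hp : 1 ≤ p) (A : Matrix (Fin n) (Fin p) ℝ) {c : ℝ}
    (h : ∀ v, ‖Matrix.toEuclideanLin A v‖ ≤ c * ‖v‖) : sMax A ≤ c := by
  obtain ⟨v, hv, hv2⟩ := exists_norm_eq_sMax hp A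
  simpa [hv, hv2] using h v

theorem sMax_transpose {n p : ℕ} (hn : 1 ≤ n) (hp : 1 ≤ p) (A : Matrix (Fin n) (Fin p) ℝ) :
    sMax A.transpose = sMax A := by
  have key : ∀ {n p : ℕ} (A : Matrix (Fin n) (Fin p) ℝ), 1 ≤ n → sMax A.transpose ≤ sMax A := by
    intro n p A hn
    refine sMax_le_of_forall_norm_le hn _ fun v => ?_
    rcases (norm_nonneg (Matrix.toEuclideanLin A.transpose v)).eq_or_lt' with h | h
    · rw [h]; exact mul_nonneg (sMax_nonneg _) (norm_nonneg _)
    refine le_of_mul_le_mul_left ?_ h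
    calc _ = inner ℝ (Matrix.toEuclideanLin A (Matrix.toEuclideanLin A.transpose v)) v := by
          rw [← LinearMap.adjoint_inner_right, ← toEuclideanLin_transpose_eq_adjoint,
            real_inner_self_eq_norm_mul_norm]
      _ ≤ _ := real_inner_le_norm _ _
      _ ≤ (sMax A * ‖Matrix.toEuclideanLin A.transpose v‖) * ‖v‖ := by
          gcongr; exact norm_le_sMax_mul _ _
      _ = _ := by ring
  exact le_antisymm (key A hn) (by simpa using key A.transpose hp)

theorem condNumber_transpose {n p : ℕ} (hn : 1 ≤ n) (hp : 1 ≤ p) (A : Matrix (Fin n) (Fin p) ℝ) :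
    condNumber A.transpose = condNumber A := by
  rw [condNumber, condNumber, sMin_transpose hn hp, sMax_transpose hn hp]

theorem sMax_sub_le {n p : ℕ} (hp : 1 ≤ p) (A B : Matrix (Fin n) (Fin p) ℝ) :
    sMax A ≤ sMax B + sMax (A - B) := by
  refine sMax_le_of_forall_norm_le hp _ fun v => ?_
  have h : Matrix.toEuclideanLin A v
      = Matrix.toEuclideanLin B v + Matrix.toEuclideanLin (A - B) v := by simp
  rw [h, add_mul]
  exact (norm_add_le _ _).trans (add_le_add (norm_le_sMax_mul _ _) (norm_le_sMax_mul _ _))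

theorem sMin_sub_le {m d : ℕ} (hd : 1 ≤ d) (hdm : d ≤ m) (A B : Matrix (Fin m) (Fin d) ℝ) :
    sMin A ≤ sMin B + sMax (A - B) := by
  obtain ⟨v, hv, hv2⟩ := exists_norm_eq_sMin hd hdm B
  have h : Matrix.toEuclideanLin A v
      = Matrix.toEuclideanLin B v + Matrix.toEuclideanLin (A - B) v := by simp
  have h1 := sMin_mul_norm_le hdm A v
  have h2 := norm_le_sMax_mul (A - B) v
  have h3 := norm_add_le (Matrix.toEuclideanLin B v) (Matrix.toEuclideanLin (A - B) v)
  rw [← h, hv2] at h3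
  rw [hv, mul_one] at h1 h2
  linarith

theorem sMax_le_sum_abs {n p : ℕ} (hp : 1 ≤ p) (A : Matrix (Fin n) (Fin p) ℝ) :
    sMax A ≤ ∑ i, ∑ j, |A i j| := by
  refine sMax_le_of_forall_norm_le hp _ fun v => ?_
  calc ‖Matrix.toEuclideanLin A v‖ ≤ ∑ i, ‖(Matrix.toEuclideanLin A v) i‖ := by
        rw [EuclideanSpace.norm_eq]
        refine Real.sqrt_le_iff.2 ⟨by positivity, ?_⟩
        exact Finset.sum_sq_le_sq_sum_of_nonneg fun i _ => norm_nonneg _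
    _ ≤ ∑ i, (∑ j, |A i j|) * ‖v‖ := by
        refine Finset.sum_le_sum fun i _ => ?_
        simp only [Matrix.toLpLin_apply, Matrix.mulVec, dotProduct, Real.norm_eq_abs]
        rw [Finset.sum_mul]
        refine (Finset.abs_sum_le_sum_abs _ _).trans (Finset.sum_le_sum fun j _ => ?_)
        rw [abs_mul]
        gcongr
        exact PiLp.norm_apply_le v j
    _ = _ := by rw [Finset.sum_mul]

/-- A function that is `1`-Lipschitz for the operator norm `sMax` is continuous. -/
theorem continuous_of_sub_le_sMax {n p : ℕ} (hp : 1 ≤ p) {f : Matrix (Fin n) (Fin p) ℝ → ℝ}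
    (hf : ∀ A B, f A ≤ f B + sMax (A - B)) : Continuous f := by
  rw [continuous_iff_continuousAt]
  intro B
  have hc : Continuous fun A : Matrix (Fin n) (Fin p) ℝ => ∑ i, ∑ j, |(A - B) i j| := by
    fun_prop
  have h0 : Tendsto (fun A : Matrix (Fin n) (Fin p) ℝ => ∑ i, ∑ j, |(A - B) i j|) (𝓝 B) (𝓝 0) := by
    simpa using hc.tendsto B
  refine tendsto_iff_norm_sub_tendsto_zero.2
    (squeeze_zero (fun _ => norm_nonneg _) (fun A => ?_) h0)
  have h1 := hf A B
  have h2 := hf B A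
  have h3 := sMax_le_sum_abs hp (A - B)
  have h4 := sMax_le_sum_abs hp (B - A)
  have h5 : ∑ i, ∑ j, |(B - A) i j| = ∑ i, ∑ j, |(A - B) i j| := by
    simp [abs_sub_comm]
  rw [Real.norm_eq_abs, abs_le]
  constructor <;> linarith

theorem continuous_sMax {n p : ℕ} (hp : 1 ≤ p) :
    Continuous (sMax : Matrix (Fin n) (Fin p) ℝ → ℝ) :=
  continuous_of_sub_le_sMax hp (sMax_sub_le hp)

theorem continuous_sMin {n p : ℕ} (hn : 1 ≤ n) (hp : 1 ≤ p) :
    Continuous (sMin : Matrix (Fin n) (Fin p) ℝ → ℝ) := by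
  rcases le_total p n with h | h
  · exact continuous_of_sub_le_sMax hp (sMin_sub_le hp h)
  · have h1 := continuous_of_sub_le_sMax hn (sMin_sub_le hn h)
    have h2 := h1.comp (continuous_id.matrix_transpose (m := Fin n) (n := Fin p) (R := ℝ))
    refine h2.congr fun A => ?_
    simp [sMin_transpose hn hp]

/-! ### The condition number after a multiplication -/

section Mul

variable {n p : ℕ} {R : Matrix (Fin p) (Fin p) ℝ} {a b : ℝ}

theorem le_sMax_mul (hp : 1 ≤ p) (ha : 0 < a) (Z : Matrix (Fin n) (Fin p) ℝ)
    (hR : ∀ v, a * ‖v‖ ≤ ‖Matrix.toEuclideanLin R v‖) : a * sMax Z ≤ sMax (Z * R) := by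
  obtain ⟨w, hw, hw2⟩ := exists_norm_eq_sMax hp Z
  have hinj : Function.Injective (Matrix.toEuclideanLin R) := by
    rw [injective_iff_map_eq_zero]
    intro v hv
    have := hR v
    rw [hv, norm_zero] at this
    exact norm_le_zero_iff.1 (by nlinarith [norm_nonneg v])
  obtain ⟨v, rfl⟩ := LinearMap.surjective_of_injective hinj w
  have h1 := norm_le_sMax_mul (Z * R) v
  rw [toEuclideanLin_mul_apply, hw2] at h1
  have h2 := hR v
  rw [hw] at h2
  calc a * sMax Z ≤ a * (sMax (Z * R) * ‖v‖) := by gcongr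
    _ = sMax (Z * R) * (a * ‖v‖) := by ring
    _ ≤ sMax (Z * R) * 1 := by gcongr; exact sMax_nonneg _
    _ = _ := mul_one _

theorem sMax_mul_le (hp : 1 ≤ p) (Z : Matrix (Fin n) (Fin p) ℝ)
    (hR : ∀ v, ‖Matrix.toEuclideanLin R v‖ ≤ b * ‖v‖) : sMax (Z * R) ≤ b * sMax Z := by
  refine sMax_le_of_forall_norm_le hp _ fun v => ?_
  rw [toEuclideanLin_mul_apply]
  calc _ ≤ sMax Z * ‖Matrix.toEuclideanLin R v‖ := norm_le_sMax_mul _ _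
    _ ≤ sMax Z * (b * ‖v‖) := by gcongr; exacts [sMax_nonneg _, hR v]
    _ = _ := by ring

theorem le_sMin_mul (hn : 1 ≤ n) (hp : 1 ≤ p) (ha : 0 < a) (hRs : R.transpose = R)
    (Z : Matrix (Fin n) (Fin p) ℝ) (hR : ∀ v, a * ‖v‖ ≤ ‖Matrix.toEuclideanLin R v‖) :
    a * sMin Z ≤ sMin (Z * R) := by
  rcases le_total p n with h | h
  · obtain ⟨v, hv, hv2⟩ := exists_norm_eq_sMin hp h (Z * R)
    rw [← hv2, toEuclideanLin_mul_apply]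
    have h1 := sMin_mul_norm_le h Z (Matrix.toEuclideanLin R v)
    have h2 := hR v
    rw [hv, mul_one] at h2
    calc a * sMin Z ≤ ‖Matrix.toEuclideanLin R v‖ * sMin Z := by
          gcongr; exact sMin_nonneg _
      _ ≤ _ := by rwa [mul_comm]
  · rw [← sMin_transpose hn hp, ← sMin_transpose hn hp, Matrix.transpose_mul, hRs]
    obtain ⟨v, hv, hv2⟩ := exists_norm_eq_sMin hn h (R * Z.transpose)
    rw [← hv2, toEuclideanLin_mul_apply]
    have h1 := sMin_mul_norm_le h Z.transpose v
    rw [hv, mul_one] at h1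
    exact (mul_le_mul_of_nonneg_left h1 ha.le).trans (hR _)

theorem sMin_mul_le (hn : 1 ≤ n) (hp : 1 ≤ p) (ha : 0 < a) (hRs : R.transpose = R)
    (Z : Matrix (Fin n) (Fin p) ℝ) (hRa : ∀ v, a * ‖v‖ ≤ ‖Matrix.toEuclideanLin R v‖)
    (hR : ∀ v, ‖Matrix.toEuclideanLin R v‖ ≤ b * ‖v‖) :
    sMin (Z * R) ≤ b * sMin Z := by
  rcases le_total p n with h | h
  · obtain ⟨w, hw, hw2⟩ := exists_norm_eq_sMin hp h Z
    have hinj : Function.Injective (Matrix.toEuclideanLin R) := by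
      rw [injective_iff_map_eq_zero]
      intro v hv
      have := hRa v
      rw [hv, norm_zero] at this
      exact norm_le_zero_iff.1 (by nlinarith [norm_nonneg v])
    obtain ⟨v, rfl⟩ := LinearMap.surjective_of_injective hinj w
    have h1 := sMin_mul_norm_le h (Z * R) v
    rw [toEuclideanLin_mul_apply, hw2] at h1
    have h2 := hR v
    rw [hw] at h2
    have hb : 0 ≤ b := by
      by_contra hb
      nlinarith [norm_nonneg v]
    calc sMin (Z * R) = sMin (Z * R) * 1 := (mul_one _).symm
      _ ≤ sMin (Z * R) * (b * ‖v‖) := by gcongr; exact sMin_nonneg _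
      _ = b * (sMin (Z * R) * ‖v‖) := by ring
      _ ≤ _ := by gcongr
  · rw [← sMin_transpose hn hp, ← sMin_transpose hn hp, Matrix.transpose_mul, hRs]
    obtain ⟨v, hv, hv2⟩ := exists_norm_eq_sMin hn h Z.transpose
    rw [← hv2]
    have h1 := sMin_mul_norm_le h (R * Z.transpose) v
    rw [hv, mul_one, toEuclideanLin_mul_apply] at h1
    exact h1.trans (hR _)

theorem ENNReal.ofReal_div_ofReal_le_mul {x y x' y' a b : ℝ} (ha : 0 < a) (hb : 0 < b)
    (hx : x' ≤ b * x) (hy : a * y ≤ y') :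
    ENNReal.ofReal x' / ENNReal.ofReal y'
      ≤ ENNReal.ofReal (b / a) * (ENNReal.ofReal x / ENNReal.ofReal y) := by
  calc ENNReal.ofReal x' / ENNReal.ofReal y'
      ≤ ENNReal.ofReal (b * x) / ENNReal.ofReal (a * y) :=
        ENNReal.div_le_div (ENNReal.ofReal_le_ofReal hx) (ENNReal.ofReal_le_ofReal hy)
    _ = _ := by
        rw [ENNReal.ofReal_mul hb.le, ENNReal.ofReal_mul ha.le, ENNReal.ofReal_div_of_pos ha,
          div_eq_mul_inv, div_eq_mul_inv, div_eq_mul_inv,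
          ENNReal.mul_inv (Or.inl (by simpa using ha)) (Or.inl ENNReal.ofReal_ne_top)]
        ring

/-- Multiplication by a symmetric matrix with singular values in `[a, b]` changes the condition
number by a factor of at most `b / a`; `condNumber_le_mul` is the converse bound. -/
theorem condNumber_mul_le (hn : 1 ≤ n) (hp : 1 ≤ p) (ha : 0 < a) (hb : 0 < b)
    (hRs : R.transpose = R) (Z : Matrix (Fin n) (Fin p) ℝ)
    (hRa : ∀ v, a * ‖v‖ ≤ ‖Matrix.toEuclideanLin R v‖)
    (hRb : ∀ v, ‖Matrix.toEuclideanLin R v‖ ≤ b * ‖v‖) :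
    condNumber (Z * R) ≤ ENNReal.ofReal (b / a) * condNumber Z :=
  ENNReal.ofReal_div_ofReal_le_mul ha hb (sMax_mul_le hp Z hRb) (le_sMin_mul hn hp ha hRs Z hRa)

theorem condNumber_le_mul (hn : 1 ≤ n) (hp : 1 ≤ p) (ha : 0 < a) (hb : 0 < b)
    (hRs : R.transpose = R) (Z : Matrix (Fin n) (Fin p) ℝ)
    (hRa : ∀ v, a * ‖v‖ ≤ ‖Matrix.toEuclideanLin R v‖)
    (hRb : ∀ v, ‖Matrix.toEuclideanLin R v‖ ≤ b * ‖v‖) :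
    condNumber Z ≤ ENNReal.ofReal (b / a) * condNumber (Z * R) := by
  have h1 := le_sMax_mul hp ha Z hRa
  have h2 := sMin_mul_le hn hp ha hRs Z hRa hRb
  have h := ENNReal.ofReal_div_ofReal_le_mul (inv_pos.2 hb) (inv_pos.2 ha)
    (x := sMax (Z * R)) (x' := sMax Z) (y := sMin (Z * R)) (y' := sMin Z)
    (by rw [inv_mul_eq_div, le_div_iff₀' ha]; exact h1)
    (by rw [inv_mul_eq_div, div_le_iff₀' hb]; exact h2)
  rwa [inv_div_inv] at h

end Mul

/-! ### The volume of the set of directions that are contracted -/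

section Volume

open Module

variable {E F : Type*} [NormedAddCommGroup E] [InnerProductSpace ℝ E]

/-- The scaling by `δ` on the orthogonal complement of the unit vector `u` that fixes `u`. -/
noncomputable def axialScaling (u : E) (δ : ℝ) : E →ₗ[ℝ] E :=
  δ • LinearMap.transvection (((1 - δ) / δ) • (innerSL ℝ u).toLinearMap) u

theorem axialScaling_apply {u : E} {δ : ℝ} (hδ : δ ≠ 0) (v : E) :
    axialScaling u δ v = inner ℝ u v • u + δ • (v - inner ℝ u v • u) := by
  simp only [axialScaling, LinearMap.smul_apply, LinearMap.transvection.apply,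
    ContinuousLinearMap.coe_coe, innerSL_apply_apply, smul_add, smul_sub, smul_eq_mul, smul_smul]
  rw [← mul_assoc, mul_div_cancel₀ _ hδ, sub_mul, sub_smul, one_mul]
  abel

theorem det_axialScaling [FiniteDimensional ℝ E] {u : E} (hu : ‖u‖ = 1) {δ : ℝ} (hδ : δ ≠ 0) (hE : 1 ≤ finrank ℝ E) :
    LinearMap.det (axialScaling u δ) = δ ^ (finrank ℝ E - 1) := by
  obtain ⟨k, hk⟩ := Nat.exists_eq_add_of_le hE
  rw [axialScaling, LinearMap.det_smul, LinearMap.transvection.det, hk]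
  simp only [LinearMap.smul_apply, ContinuousLinearMap.coe_coe, innerSL_apply_apply,
    real_inner_self_eq_norm_sq, hu, smul_eq_mul]
  rw [Nat.add_sub_cancel_left, pow_add]
  field_simp
  ring

theorem norm_axialScaling_le {u : E} (hu : ‖u‖ = 1) {δ : ℝ} (hδ : 0 < δ) (hδ1 : δ ≤ 1) (v : E) :
    ‖axialScaling u δ v‖ ≤ ‖v‖ := by
  have h : axialScaling u δ v = (1 - δ) • (inner ℝ u v • u) + δ • v := by
    rw [axialScaling_apply hδ.ne']; module
  have h1 : |inner ℝ u v| ≤ ‖v‖ := by simpa [hu] using abs_real_inner_le_norm u v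
  rw [h]
  refine (norm_add_le _ _).trans ?_
  rw [norm_smul, norm_smul, norm_smul, hu, Real.norm_of_nonneg hδ.le,
    Real.norm_of_nonneg (sub_nonneg.2 hδ1), Real.norm_eq_abs]
  nlinarith

/-- If `T` has norm at most `L` and contracts the unit vector `u` to norm at most `s`, then it
contracts a whole ellipsoid around `u` to norm at most `2 s`. The axis of this ellipsoid in the
direction of `u` has length of order one, and this is why only the power `dim E - 1` of the
aspect ratio `δ` occurs. -/
theorem volume_contracted_ge [FiniteDimensional ℝ E] [MeasurableSpace E] [BorelSpace E]
    {F : Type*} [NormedAddCommGroup F] [NormedSpace ℝ F] (hE : 1 ≤ finrank ℝ E) (T : E →ₗ[ℝ] F) {u : E} (hu : ‖u‖ = 1)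
    {s L δ : ℝ} (hs : ‖T u‖ ≤ s) (hL : ∀ v, ‖T v‖ ≤ L * ‖v‖) (hδ : 0 < δ) (hδ1 : δ ≤ 1)
    (hδL : δ * L ≤ s) :
    ENNReal.ofReal (δ ^ (finrank ℝ E - 1)) * volume (Metric.closedBall (0 : E) (1 / 2)) ≤
      volume {v : E | (1 / 2 ≤ ‖v‖ ∧ ‖v‖ ≤ 3 / 2) ∧ ‖T v‖ ≤ 2 * s} := by
  have h1 : volume ((fun v => u + v) '' (axialScaling u δ '' Metric.closedBall (0 : E) (1 / 2)))
      = ENNReal.ofReal (δ ^ (finrank ℝ E - 1)) * volume (Metric.closedBall (0 : E) (1 / 2)) := by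
    rw [Set.image_add_left, measure_preimage_add, Measure.addHaar_image_linearMap,
      det_axialScaling hu hδ.ne' hE, abs_of_pos (by positivity)]
  rw [← h1]
  refine measure_mono ?_
  rintro _ ⟨_, ⟨w, hw, rfl⟩, rfl⟩
  rw [mem_closedBall_zero_iff] at hw
  have hS := norm_axialScaling_le hu hδ hδ1 w
  have hin : |inner ℝ u w| ≤ ‖w‖ := by simpa [hu] using abs_real_inner_le_norm u w
  have hperp : ‖w - inner ℝ u w • u‖ ≤ ‖w‖ := by
    refine le_of_sq_le_sq ?_ (norm_nonneg _)
    rw [norm_sub_sq_real, norm_smul, hu, real_inner_smul_right, real_inner_comm, Real.norm_eq_abs,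
      mul_one, sq_abs]
    nlinarith [sq_nonneg (inner ℝ u w)]
  have hL0 : 0 ≤ L := by simpa [hu] using (norm_nonneg _).trans (hL u)
  have hs0 : 0 ≤ s := (norm_nonneg _).trans hs
  refine ⟨⟨?_, ?_⟩, ?_⟩
  · have := norm_sub_le_norm_add u (axialScaling u δ w)
    rw [hu] at this
    linarith
  · have := norm_add_le u (axialScaling u δ w)
    rw [hu] at this
    linarith
  · have hT : T (u + axialScaling u δ w)
        = T u + (inner ℝ u w • T u + δ • T (w - inner ℝ u w • u)) := by
      rw [axialScaling_apply hδ.ne', map_add, map_add, map_smul, map_smul]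
    rw [hT]
    refine (norm_add_le _ _).trans ?_
    have h2 := norm_add_le (inner ℝ u w • T u) (δ • T (w - inner ℝ u w • u))
    rw [norm_smul, norm_smul, Real.norm_of_nonneg hδ.le, Real.norm_eq_abs] at h2
    have h3 : |inner ℝ u w| * ‖T u‖ ≤ 1 / 2 * s :=
      mul_le_mul (hin.trans hw) hs (norm_nonneg _) (by norm_num)
    have h4 : δ * ‖T (w - inner ℝ u w • u)‖ ≤ 1 / 2 * s := by
      calc _ ≤ δ * (L * ‖w - inner ℝ u w • u‖) := by gcongr; exact hL _
        _ ≤ δ * (L * (1 / 2)) := by gcongr; exact hperp.trans hw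
        _ = 1 / 2 * (δ * L) := by ring
        _ ≤ _ := by gcongr
    linarith

end Volume

/-! ### Standard Gaussian matrices -/

/-- The law of an `n × p` matrix with independent standard normal entries. -/
noncomputable def stdGaussianMatrix (n p : ℕ) : Measure (Fin n → Fin p → ℝ) :=
  Measure.pi fun _ => Measure.pi fun _ => gaussianReal 0 1

instance (n p : ℕ) : IsProbabilityMeasure (stdGaussianMatrix n p) := by
  unfold stdGaussianMatrix; infer_instance

/-- Transposition preserves the law; both iterated products are images of the product over all
entries. -/
theorem measurePreserving_swap_stdGaussianMatrix (n p : ℕ) :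
    MeasurePreserving (fun (Z : Fin n → Fin p → ℝ) j i => Z i j)
      (stdGaussianMatrix n p) (stdGaussianMatrix p n) := by
  have hm : Measurable (fun (Z : Fin n → Fin p → ℝ) j i => Z i j) := by fun_prop
  refine ⟨hm, ?_⟩
  have h : ∀ a b : ℕ, stdGaussianMatrix a b
      = (Measure.infinitePi fun _ : Fin a × Fin b => gaussianReal 0 1).map
        (MeasurableEquiv.curry (Fin a) (Fin b) ℝ) := by
    intro a b
    rw [Measure.infinitePi_map_curry (fun (_ : Fin a) (_ : Fin b) => gaussianReal 0 1)]
    simp only [Measure.infinitePi_eq_pi]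
    rfl
  have hc := Measure.infinitePi_map_piCongrLeft
    (fun _ : Fin p × Fin n => gaussianReal 0 1) (Equiv.prodComm (Fin n) (Fin p))
  rw [h, h, ← hc, Measure.map_map hm (MeasurableEquiv.measurable _),
    Measure.map_map (MeasurableEquiv.measurable _) (MeasurableEquiv.measurable _)]
  congr 1

theorem map_pi_gaussianReal_sum_mul {d : ℕ} (u : EuclideanSpace ℝ (Fin d)) :
    (Measure.pi fun _ : Fin d => gaussianReal 0 1).map (fun x => ∑ j, x j * u j)
      = (gaussianReal 0 1).map (fun x => ‖u‖ * x) := by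
  have h : (fun x : Fin d → ℝ => ∑ j, x j * u j) = (innerSL ℝ u) ∘ (WithLp.toLp 2) := by
    ext x; simp [PiLp.inner_apply]
  rw [h, ← Measure.map_map (by fun_prop) (by fun_prop), map_pi_eq_stdGaussian,
    IsGaussian.map_eq_gaussianReal, gaussianReal_map_const_mul, variance_dual_stdGaussian,
    integral_strongDual_stdGaussian, innerSL_apply_norm, mul_zero, mul_one]
  congr 1
  ext; simp

theorem integral_exp_neg_mul_sq_gaussianReal {t : ℝ} (ht : 0 < 1 + 2 * t) :
    ∫ x, Real.exp (-t * x ^ 2) ∂(gaussianReal 0 1) = (√(1 + 2 * t))⁻¹ := by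
  rw [integral_gaussianReal_eq_integral_smul one_ne_zero]
  have h : ∀ x : ℝ, gaussianPDFReal 0 1 x • Real.exp (-t * x ^ 2)
      = (√(2 * Real.pi))⁻¹ * Real.exp (-((1 + 2 * t) / 2) * x ^ 2) := by
    intro x
    simp only [gaussianPDFReal, NNReal.coe_one, mul_one, sub_zero, smul_eq_mul]
    rw [mul_assoc, ← Real.exp_add]
    congr 2; ring
  simp_rw [h]
  rw [integral_const_mul, integral_gaussian, ← Real.sqrt_inv, ← Real.sqrt_inv, ← Real.sqrt_mul
    (by positivity)]
  congr 1
  have := Real.pi_pos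
  field_simp

theorem integral_exp_neg_mul_sq_sum_mul {d : ℕ} (u : EuclideanSpace ℝ (Fin d)) {t : ℝ}
    (ht : 0 < 1 + 2 * (t * ‖u‖ ^ 2)) :
    ∫ x, Real.exp (-t * (∑ j, x j * u j) ^ 2) ∂(Measure.pi fun _ : Fin d => gaussianReal 0 1)
      = (√(1 + 2 * (t * ‖u‖ ^ 2)))⁻¹ := by
  have hm : Measurable fun x : Fin d → ℝ => ∑ j, x j * u j := by fun_prop
  have h1 : ∫ x, Real.exp (-t * (∑ j, x j * u j) ^ 2)
        ∂(Measure.pi fun _ : Fin d => gaussianReal 0 1)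
      = ∫ y, Real.exp (-t * y ^ 2)
        ∂((Measure.pi fun _ : Fin d => gaussianReal 0 1).map (fun x => ∑ j, x j * u j)) := by
    rw [integral_map hm.aemeasurable (by fun_prop)]
  rw [h1, map_pi_gaussianReal_sum_mul, integral_map (by fun_prop) (by fun_prop),
    ← integral_exp_neg_mul_sq_gaussianReal ht]
  congr 1; ext x; congr 1; ring

theorem norm_sq_toEuclideanLin_of {m d : ℕ} (Z : Fin m → Fin d → ℝ)
    (u : EuclideanSpace ℝ (Fin d)) :
    ‖Matrix.toEuclideanLin (Matrix.of Z) u‖ ^ 2 = ∑ i, (∑ j, Z i j * u j) ^ 2 := by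
  rw [EuclideanSpace.real_norm_sq_eq]
  simp [Matrix.toLpLin_apply, Matrix.mulVec, dotProduct]

theorem continuous_norm_toEuclideanLin_of {m d : ℕ} :
    Continuous fun q : (Fin m → Fin d → ℝ) × EuclideanSpace ℝ (Fin d) =>
      ‖Matrix.toEuclideanLin (Matrix.of q.1) q.2‖ := by
  have h : ∀ q : (Fin m → Fin d → ℝ) × EuclideanSpace ℝ (Fin d),
      ‖Matrix.toEuclideanLin (Matrix.of q.1) q.2‖ = √(∑ i, (∑ j, q.1 i j * q.2 j) ^ 2) := by
    intro q
    rw [← norm_sq_toEuclideanLin_of, Real.sqrt_sq (norm_nonneg _)]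
  simp_rw [h]
  fun_prop

theorem measurable_norm_toEuclideanLin_of {m d : ℕ} (u : EuclideanSpace ℝ (Fin d)) :
    Measurable fun Z : Fin m → Fin d → ℝ => ‖Matrix.toEuclideanLin (Matrix.of Z) u‖ :=
  (continuous_norm_toEuclideanLin_of.comp (by fun_prop : Continuous fun Z => (Z, u))).measurable

/-- The Laplace transform of `‖Z u‖²` for a standard Gaussian matrix `Z`, on its whole domain. -/
theorem lintegral_exp_neg_mul_norm_sq (m : ℕ) {d : ℕ} (u : EuclideanSpace ℝ (Fin d)) {t : ℝ}
    (ht : 0 < 1 + 2 * (t * ‖u‖ ^ 2)) :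
    ∫⁻ Z, ENNReal.ofReal (Real.exp (-t * ‖Matrix.toEuclideanLin (Matrix.of Z) u‖ ^ 2))
        ∂(stdGaussianMatrix m d)
      = ENNReal.ofReal ((√(1 + 2 * (t * ‖u‖ ^ 2)))⁻¹ ^ m) := by
  have h : ∀ Z : Fin m → Fin d → ℝ,
      Real.exp (-t * ‖Matrix.toEuclideanLin (Matrix.of Z) u‖ ^ 2)
        = ∏ i, Real.exp (-t * (∑ j, Z i j * u j) ^ 2) := by
    intro Z
    rw [norm_sq_toEuclideanLin_of, Finset.mul_sum, Real.exp_sum]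
  have hI : ∫ Z, Real.exp (-t * ‖Matrix.toEuclideanLin (Matrix.of Z) u‖ ^ 2)
      ∂(stdGaussianMatrix m d) = (√(1 + 2 * (t * ‖u‖ ^ 2)))⁻¹ ^ m := by
    simp_rw [h]
    rw [stdGaussianMatrix, integral_fintype_prod_eq_prod
      (f := fun (_ : Fin m) (x : Fin d → ℝ) => Real.exp (-t * (∑ j, x j * u j) ^ 2))]
    rw [Finset.prod_congr rfl fun _ _ => integral_exp_neg_mul_sq_sum_mul u ht]
    simp
  rw [← hI, ofReal_integral_eq_lintegral_ofReal]
  · exact Integrable.of_integral_ne_zero (by rw [hI]; positivity)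
  · exact ae_of_all _ fun _ => Real.exp_nonneg _

theorem Real.exp_half_le_two : Real.exp (1 / 2) ≤ 2 := by
  have h := Real.exp_one_lt_d9
  have h2 : Real.exp (1 / 2) ^ 2 = Real.exp 1 := by rw [← Real.exp_nat_mul]; norm_num
  nlinarith [Real.exp_pos (1 / 2)]

/-- The small ball estimate that follows from the Laplace transform by Markov's inequality. -/
theorem measure_norm_le_mul_sqrt (m : ℕ) {d : ℕ} {u : EuclideanSpace ℝ (Fin d)}
    (hu : 1 / 2 ≤ ‖u‖) {y : ℝ} (hy : 0 < y) :
    stdGaussianMatrix m d {Z | ‖Matrix.toEuclideanLin (Matrix.of Z) u‖ ≤ y * √m}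
      ≤ ENNReal.ofReal ((4 * y) ^ m) := by
  -- this `t` optimises Markov's inequality up to constants
  set t : ℝ := 1 / (2 * y ^ 2) with ht
  have htpos : 0 < t := by positivity
  have h1 := lintegral_exp_neg_mul_norm_sq m u (t := t) (by positivity)
  have h2 := mul_meas_ge_le_lintegral₀ (μ := stdGaussianMatrix m d)
    (f := fun Z => ENNReal.ofReal
      (Real.exp (-t * ‖Matrix.toEuclideanLin (Matrix.of Z) u‖ ^ 2)))
    (((measurable_norm_toEuclideanLin_of u).pow_const 2).const_mul _).exp.ennreal_ofReal.aemeasurable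
    (ENNReal.ofReal (Real.exp (-(1 / 2)) ^ m))
  rw [h1] at h2
  have hsub : {Z : Fin m → Fin d → ℝ | ‖Matrix.toEuclideanLin (Matrix.of Z) u‖ ≤ y * √m}
      ⊆ {Z | ENNReal.ofReal (Real.exp (-(1 / 2)) ^ m) ≤ ENNReal.ofReal
        (Real.exp (-t * ‖Matrix.toEuclideanLin (Matrix.of Z) u‖ ^ 2))} := by
    intro Z hZ
    refine ENNReal.ofReal_le_ofReal ?_
    rw [← Real.exp_nat_mul, Real.exp_le_exp]
    have h3 : ‖Matrix.toEuclideanLin (Matrix.of Z) u‖ ^ 2 ≤ y ^ 2 * m := by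
      calc _ ≤ (y * √m) ^ 2 := pow_le_pow_left₀ (norm_nonneg _) hZ 2
        _ = _ := by rw [mul_pow, Real.sq_sqrt (Nat.cast_nonneg _)]
    have h4 : t * ‖Matrix.toEuclideanLin (Matrix.of Z) u‖ ^ 2 ≤ t * (y ^ 2 * m) := by gcongr
    have h5 : t * (y ^ 2 * m) = m / 2 := by rw [ht]; field_simp
    linarith
  have hbase : (√(1 + 2 * (t * ‖u‖ ^ 2)))⁻¹ ≤ 2 * y := by
    rw [inv_le_comm₀ (by positivity) (by positivity)]
    refine Real.le_sqrt_of_sq_le ?_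
    have h6 : (1 / 2 : ℝ) ^ 2 ≤ ‖u‖ ^ 2 := by gcongr
    calc ((2 * y)⁻¹) ^ 2 = 2 * (t * (1 / 2) ^ 2) := by rw [ht]; field_simp
      _ ≤ 2 * (t * ‖u‖ ^ 2) := by gcongr
      _ ≤ _ := by linarith
  have h7 : ENNReal.ofReal (Real.exp (-(1 / 2)) ^ m)
      * stdGaussianMatrix m d {Z | ‖Matrix.toEuclideanLin (Matrix.of Z) u‖ ≤ y * √m}
      ≤ ENNReal.ofReal ((2 * y) ^ m) :=
    ((mul_le_mul_right (measure_mono hsub) _).trans h2).trans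
      (ENNReal.ofReal_le_ofReal (pow_le_pow_left₀ (by positivity) hbase m))
  calc _ = ENNReal.ofReal (Real.exp (1 / 2) ^ m) * (ENNReal.ofReal (Real.exp (-(1 / 2)) ^ m)
      * stdGaussianMatrix m d {Z | ‖Matrix.toEuclideanLin (Matrix.of Z) u‖ ≤ y * √m}) := by
        rw [← mul_assoc, ← ENNReal.ofReal_mul (by positivity), ← mul_pow, ← Real.exp_add]
        simp
    _ ≤ ENNReal.ofReal (Real.exp (1 / 2) ^ m) * ENNReal.ofReal ((2 * y) ^ m) := by gcongr
    _ = ENNReal.ofReal ((Real.exp (1 / 2) * (2 * y)) ^ m) := by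
        rw [← ENNReal.ofReal_mul (by positivity), mul_pow (Real.exp (1 / 2))]
    _ ≤ _ := by
        refine ENNReal.ofReal_le_ofReal (pow_le_pow_left₀ (by positivity) ?_ m)
        nlinarith [Real.exp_half_le_two]

theorem lintegral_Ioc_rpow {a : ℝ} (ha : 0 < a) :
    ∫⁻ t in Set.Ioc (0 : ℝ) 1, ENNReal.ofReal (t ^ (a - 1)) = ENNReal.ofReal (1 / a) := by
  have hint : IntegrableOn (fun t : ℝ => t ^ (a - 1)) (Set.Ioc 0 1) := by
    rw [← intervalIntegrable_iff_integrableOn_Ioc_of_le zero_le_one]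
    exact intervalIntegral.intervalIntegrable_rpow' (by linarith)
  rw [← ofReal_integral_eq_lintegral_ofReal hint]
  · rw [← intervalIntegral.integral_of_le zero_le_one, integral_rpow (Or.inl (by linarith))]
    simp [Real.zero_rpow ha.ne']
  · filter_upwards [ae_restrict_mem measurableSet_Ioc] with t ht
    exact Real.rpow_nonneg ht.1.le _

theorem lintegral_Ioi_rpow {b : ℝ} (hb : 0 < b) :
    ∫⁻ t in Set.Ioi (1 : ℝ), ENNReal.ofReal (t ^ (-b - 1)) = ENNReal.ofReal (1 / b) := by
  rw [← ofReal_integral_eq_lintegral_ofReal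
    (integrableOn_Ioi_rpow_of_lt (by linarith) zero_lt_one)]
  · rw [integral_Ioi_rpow_of_lt (by linarith) zero_lt_one]
    simp [neg_div_neg_eq]
  · filter_upwards [ae_restrict_mem measurableSet_Ioi] with t ht
    exact Real.rpow_nonneg (zero_le_one.trans (le_of_lt ht)) _

/-- Negative moments of `‖Z u‖`. The truncation at `η` keeps the integrand real-valued; the
bound does not depend on it. -/
theorem lintegral_rpow_sqrt_div_norm_le (m : ℕ) {d : ℕ} {u : EuclideanSpace ℝ (Fin d)}
    (hu : 1 / 2 ≤ ‖u‖) {η a : ℝ} (hη : 0 < η) (ha : 0 < a) (ham : a < m) :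
    ∫⁻ Z, ENNReal.ofReal ((√m / max ‖Matrix.toEuclideanLin (Matrix.of Z) u‖ η) ^ a)
        ∂(stdGaussianMatrix m d)
      ≤ ENNReal.ofReal (1 + 4 ^ m * (a / (m - a))) := by
  have hm := measurable_norm_toEuclideanLin_of (m := m) u
  have hf : Measurable fun Z : Fin m → Fin d → ℝ =>
      √m / max ‖Matrix.toEuclideanLin (Matrix.of Z) u‖ η :=
    measurable_const.div (hm.max measurable_const)
  rw [lintegral_rpow_eq_lintegral_meas_le_mul _ (ae_of_all _ fun Z => by
      simp only [Pi.zero_apply]; positivity)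
      hf.aemeasurable ha,
    ← Set.Ioc_union_Ioi_eq_Ioi zero_le_one,
    lintegral_union measurableSet_Ioi
      (Set.Ioc_disjoint_Ioi le_rfl)]
  have hA : ∫⁻ t in Set.Ioc (0 : ℝ) 1, stdGaussianMatrix m d
        {Z | t ≤ √m / max ‖Matrix.toEuclideanLin (Matrix.of Z) u‖ η} * ENNReal.ofReal (t ^ (a - 1))
      ≤ ENNReal.ofReal (1 / a) := by
    rw [← lintegral_Ioc_rpow ha]
    exact lintegral_mono fun t => mul_le_of_le_one_left (zero_le) prob_le_one
  have hB : ∫⁻ t in Set.Ioi (1 : ℝ), stdGaussianMatrix m d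
        {Z | t ≤ √m / max ‖Matrix.toEuclideanLin (Matrix.of Z) u‖ η} * ENNReal.ofReal (t ^ (a - 1))
      ≤ ENNReal.ofReal (4 ^ m * (1 / (m - a))) := by
    rw [ENNReal.ofReal_mul (by positivity), ← lintegral_Ioi_rpow (sub_pos.2 ham),
      ← lintegral_const_mul _ (by fun_prop)]
    refine setLIntegral_mono' measurableSet_Ioi fun t ht => ?_
    have ht0 : 0 < t := zero_lt_one.trans ht
    have h1 : {Z : Fin m → Fin d → ℝ |
          t ≤ √m / max ‖Matrix.toEuclideanLin (Matrix.of Z) u‖ η}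
        ⊆ {Z | ‖Matrix.toEuclideanLin (Matrix.of Z) u‖ ≤ t⁻¹ * √m} := by
      intro Z hZ
      have h2 : 0 < max ‖Matrix.toEuclideanLin (Matrix.of Z) u‖ η := lt_max_of_lt_right hη
      have h3 := (le_div_iff₀ h2).1 hZ
      refine (le_max_left _ η).trans ?_
      rwa [inv_mul_eq_div, le_div_iff₀' ht0]
    calc _ ≤ ENNReal.ofReal ((4 * t⁻¹) ^ m) * ENNReal.ofReal (t ^ (a - 1)) := by
          gcongr
          exact (measure_mono h1).trans (measure_norm_le_mul_sqrt m hu (inv_pos.2 ht0))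
      _ = _ := by
          rw [← ENNReal.ofReal_mul (by positivity), ← ENNReal.ofReal_mul (by positivity), mul_pow,
            mul_assoc]
          congr 2
          rw [show -((m : ℝ) - a) - 1 = (a - 1) - (m : ℝ) by ring, Real.rpow_sub ht0 (a - 1),
            Real.rpow_natCast, inv_pow]
          ring
  calc _ ≤ ENNReal.ofReal a * (ENNReal.ofReal (1 / a) + ENNReal.ofReal (4 ^ m * (1 / (m - a)))) := by
        gcongr
    _ = _ := by
        have := sub_pos.2 ham
        rw [← ENNReal.ofReal_add (by positivity) (by positivity), ← ENNReal.ofReal_mul ha.le]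
        congr 1
        field_simp

/-! ### Moments of the condition number of a tall standard Gaussian matrix -/

theorem measurable_sMax_of {n p : ℕ} (hp : 1 ≤ p) :
    Measurable fun Z : Fin n → Fin p → ℝ => sMax (Matrix.of Z) :=
  ((continuous_sMax hp).comp (continuous_id : Continuous fun Z : Fin n → Fin p → ℝ => Z)).measurable

theorem measurable_sMin_of {n p : ℕ} (hn : 1 ≤ n) (hp : 1 ≤ p) :
    Measurable fun Z : Fin n → Fin p → ℝ => sMin (Matrix.of Z) :=
  ((continuous_sMin hn hp).comp
    (continuous_id : Continuous fun Z : Fin n → Fin p → ℝ => Z)).measurable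

theorem measurable_condNumber_of {n p : ℕ} (hn : 1 ≤ n) (hp : 1 ≤ p) :
    Measurable fun Z : Fin n → Fin p → ℝ => condNumber (Matrix.of Z) :=
  (measurable_sMax_of hp).ennreal_ofReal.div (measurable_sMin_of hn hp).ennreal_ofReal

/-- If each value of `f` is bounded, up to the volume of a ball of radius `1 / 2`, by the integral
of `g` over a subset `D` of the ball of radius `3 / 2`, then averaging over the random matrix
costs only the ratio of the two volumes. -/
theorem lintegral_le_of_mul_volume_le {m d : ℕ} {f : (Fin m → Fin d → ℝ) → ℝ≥0∞}
    {g : (Fin m → Fin d → ℝ) × EuclideanSpace ℝ (Fin d) → ℝ≥0∞} (hg : Measurable g)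
    {D : Set (EuclideanSpace ℝ (Fin d))} (hD : MeasurableSet D)
    (hD2 : D ⊆ Metric.closedBall 0 (3 / 2)) {C : ℝ≥0∞}
    (hfg : ∀ Z, f Z * volume (Metric.closedBall (0 : EuclideanSpace ℝ (Fin d)) (1 / 2))
      ≤ ∫⁻ u in D, g (Z, u))
    (hC : ∀ u ∈ D, ∫⁻ Z, g (Z, u) ∂(stdGaussianMatrix m d) ≤ C) :
    ∫⁻ Z, f Z ∂(stdGaussianMatrix m d) ≤ 3 ^ d * C := by
  set V := volume (Metric.closedBall (0 : EuclideanSpace ℝ (Fin d)) (1 / 2)) with hV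
  have hV0 : V ≠ 0 := (Metric.measure_closedBall_pos _ _ (by norm_num)).ne'
  have hVt : V ≠ ∞ := measure_closedBall_lt_top.ne
  have hV3 : volume (Metric.closedBall (0 : EuclideanSpace ℝ (Fin d)) (3 / 2)) = 3 ^ d * V := by
    have := Measure.addHaar_closedBall_mul (volume : Measure (EuclideanSpace ℝ (Fin d))) 0
      (r := 3) (s := 1 / 2) (by norm_num) (by norm_num)
    rw [finrank_euclideanSpace_fin] at this
    rw [hV, show (3 / 2 : ℝ) = 3 * (1 / 2) by norm_num, this, ENNReal.ofReal_pow (by norm_num)]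
    norm_num
  have h : (∫⁻ Z, f Z ∂(stdGaussianMatrix m d)) * V ≤ (3 ^ d * C) * V := by
    rw [← lintegral_mul_const' _ _ hVt]
    calc _ ≤ ∫⁻ Z, (∫⁻ u in D, g (Z, u)) ∂(stdGaussianMatrix m d) := lintegral_mono hfg
      _ = ∫⁻ u in D, ∫⁻ Z, g (Z, u) ∂(stdGaussianMatrix m d) :=
        lintegral_lintegral_swap (f := fun Z u => g (Z, u)) hg.aemeasurable
      _ ≤ ∫⁻ _ in D, C := setLIntegral_mono' hD hC
      _ = C * volume D := setLIntegral_const _ _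
      _ ≤ C * (3 ^ d * V) := by rw [← hV3]; gcongr
      _ = _ := by ring
  rw [← ENNReal.le_div_iff_mul_le (Or.inl hV0) (Or.inl hVt)] at h
  refine h.trans (le_of_eq ?_)
  rw [mul_div_assoc, ENNReal.div_self hV0 hVt, mul_one]

theorem measurable_norm_toEuclideanLin {m d : ℕ} (A : Matrix (Fin m) (Fin d) ℝ) :
    Measurable fun u : EuclideanSpace ℝ (Fin d) => ‖Matrix.toEuclideanLin A u‖ :=
  (LinearMap.continuous_of_finiteDimensional (Matrix.toEuclideanLin A)).norm.measurable

/-- The case `sMax = 0` is harmless: there `s / 0 = 0`, and the left side is then at most its value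
for aspect ratio one. -/
theorem rpow_mul_pow_mul_volume_le {m d : ℕ} (hd : 1 ≤ d) (hdm : d ≤ m) {a η : ℝ} (ha : 0 < a)
    (hη : 0 < η) (Z : Fin m → Fin d → ℝ) :
    ENNReal.ofReal ((√m / (2 * max (sMin (Matrix.of Z)) η)) ^ a
        * (min 1 (max (sMin (Matrix.of Z)) η / sMax (Matrix.of Z))) ^ (d - 1))
        * volume (Metric.closedBall (0 : EuclideanSpace ℝ (Fin d)) (1 / 2))
      ≤ ∫⁻ v in {v : EuclideanSpace ℝ (Fin d) | 1 / 2 ≤ ‖v‖ ∧ ‖v‖ ≤ 3 / 2}, ENNReal.ofReal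
          ((√m / max ‖Matrix.toEuclideanLin (Matrix.of Z) v‖ η) ^ a) := by
  set s := max (sMin (Matrix.of Z)) η with hs
  set L := sMax (Matrix.of Z) with hL
  have hs0 : 0 < s := lt_max_of_lt_right hη
  have hL0 : 0 ≤ L := sMax_nonneg _
  obtain ⟨u, hu, hu2⟩ := exists_norm_eq_sMin hd hdm (Matrix.of Z)
  obtain ⟨δ, hδ, hδ1, hδL, hmin⟩ : ∃ δ : ℝ, 0 < δ ∧ δ ≤ 1 ∧ δ * L ≤ s ∧ min 1 (s / L) ≤ δ := by
    rcases hL0.eq_or_lt' with h | h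
    · exact ⟨1, one_pos, le_rfl, by rw [h]; simpa using hs0.le, min_le_left _ _⟩
    · exact ⟨min 1 (s / L), lt_min one_pos (by positivity), min_le_left _ _,
        (le_div_iff₀ h).1 (min_le_right _ _), le_rfl⟩
  have hvol := volume_contracted_ge (by simpa using hd) (Matrix.toEuclideanLin (Matrix.of Z)) hu
    (s := s) (hu2.le.trans (le_max_left _ _)) (norm_le_sMax_mul _) hδ hδ1 hδL
  rw [finrank_euclideanSpace_fin] at hvol
  set V := volume (Metric.closedBall (0 : EuclideanSpace ℝ (Fin d)) (1 / 2))
  have hmin0 : 0 ≤ min 1 (s / L) := by positivity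
  set T := {v : EuclideanSpace ℝ (Fin d) | (1 / 2 ≤ ‖v‖ ∧ ‖v‖ ≤ 3 / 2) ∧
    ‖Matrix.toEuclideanLin (Matrix.of Z) v‖ ≤ 2 * s} with hT
  have hTm : MeasurableSet T :=
    ((measurableSet_le measurable_const measurable_norm).inter
      (measurableSet_le measurable_norm measurable_const)).inter
      (measurableSet_le (measurable_norm_toEuclideanLin _) measurable_const)
  have hpow : (√m / (2 * s)) ^ a * min 1 (s / L) ^ (d - 1)
      ≤ (√m / (2 * s)) ^ a * δ ^ (d - 1) :=
    mul_le_mul_of_nonneg_left (pow_le_pow_left₀ hmin0 hmin _) (by positivity)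
  calc _ ≤ ENNReal.ofReal ((√m / (2 * s)) ^ a * δ ^ (d - 1)) * V :=
        mul_le_mul_left (ENNReal.ofReal_le_ofReal hpow) V
    _ = ENNReal.ofReal ((√m / (2 * s)) ^ a) * (ENNReal.ofReal (δ ^ (d - 1)) * V) := by
        rw [ENNReal.ofReal_mul (by positivity), mul_assoc]
    _ ≤ ENNReal.ofReal ((√m / (2 * s)) ^ a) * volume T := by gcongr
    _ = ∫⁻ _ in T, ENNReal.ofReal ((√m / (2 * s)) ^ a) := (setLIntegral_const _ _).symm
    _ ≤ ∫⁻ v in T, ENNReal.ofReal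
        ((√m / max ‖Matrix.toEuclideanLin (Matrix.of Z) v‖ η) ^ a) := by
        refine setLIntegral_mono' hTm fun v hv => ENNReal.ofReal_le_ofReal ?_
        have h1 : 0 < max ‖Matrix.toEuclideanLin (Matrix.of Z) v‖ η := lt_max_of_lt_right hη
        have h2 : max ‖Matrix.toEuclideanLin (Matrix.of Z) v‖ η ≤ 2 * s :=
          max_le hv.2 (by linarith [le_max_right (sMin (Matrix.of Z)) η])
        gcongr
    _ ≤ _ := lintegral_mono_set fun v hv => hv.1

/-- The smallest singular value `s`, truncated at `η`, enters with the exponent `-a + (d - 1)`, where `a` may be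
arbitrarily close to `m`; this is the full range in which negative moments are finite. -/
theorem lintegral_rpow_mul_pow_le {m d : ℕ} (hd : 1 ≤ d) (hdm : d ≤ m) {a η : ℝ} (ha : 0 < a)
    (ham : a < m) (hη : 0 < η) :
    ∫⁻ Z, ENNReal.ofReal ((√m / (2 * max (sMin (Matrix.of Z)) η)) ^ a
        * (min 1 (max (sMin (Matrix.of Z)) η / sMax (Matrix.of Z))) ^ (d - 1))
        ∂(stdGaussianMatrix m d)
      ≤ ENNReal.ofReal (3 ^ d * (1 + 4 ^ m * (a / (m - a)))) := by
  have hma := sub_pos.2 ham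
  rw [ENNReal.ofReal_mul (by positivity), ENNReal.ofReal_pow (by positivity), ENNReal.ofReal_ofNat]
  refine lintegral_le_of_mul_volume_le
    (g := fun q => ENNReal.ofReal
      ((√m / max ‖Matrix.toEuclideanLin (Matrix.of q.1) q.2‖ η) ^ a))
    (D := {u | 1 / 2 ≤ ‖u‖ ∧ ‖u‖ ≤ 3 / 2}) ?_ ?_ ?_ ?_ ?_
  · exact ((measurable_const.div (continuous_norm_toEuclideanLin_of.measurable.max
      measurable_const)).pow_const a).ennreal_ofReal
  · exact (measurableSet_le measurable_const measurable_norm).inter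
      (measurableSet_le measurable_norm measurable_const)
  · exact fun u hu => mem_closedBall_zero_iff.2 hu.2
  · exact rpow_mul_pow_mul_volume_le hd hdm ha hη
  · exact fun u hu => lintegral_rpow_sqrt_div_norm_le m hu.1 hη ha ham

/-- Near a unit vector at which the norm is attained, `‖Z v‖` is at least half of `sMax`. The
constant `1 / 9` in front of `‖Z v‖²` keeps its Laplace transform finite for `‖v‖ ≤ 3 / 2`. -/
theorem lintegral_exp_sMax_sq_le {m d : ℕ} (hd : 1 ≤ d) (hdm : d ≤ m) :
    ∫⁻ Z, ENNReal.ofReal (Real.exp (sMax (Matrix.of Z) ^ 2 / 36)) ∂(stdGaussianMatrix m d)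
      ≤ ENNReal.ofReal (6 ^ m) := by
  have h : ∫⁻ Z, ENNReal.ofReal (Real.exp (sMax (Matrix.of Z) ^ 2 / 36)) ∂(stdGaussianMatrix m d)
      ≤ 3 ^ d * ENNReal.ofReal (2 ^ m) := by
    refine lintegral_le_of_mul_volume_le
      (g := fun q => ENNReal.ofReal (Real.exp
        (-(-(1 / 9)) * ‖Matrix.toEuclideanLin (Matrix.of q.1) q.2‖ ^ 2)))
      (D := Metric.closedBall 0 (3 / 2)) ?_ Metric.isClosed_closedBall.measurableSet le_rfl ?_ ?_
    · exact ((continuous_norm_toEuclideanLin_of.measurable.pow_const 2).const_mul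
        _).exp.ennreal_ofReal
    · intro Z
      obtain ⟨u, hu, hu2⟩ := exists_norm_eq_sMax hd (Matrix.of Z)
      have hmem : ∀ v ∈ Metric.closedBall u (1 / 2), ‖v - u‖ ≤ 1 / 2 := fun v hv => by
        rwa [mem_closedBall_iff_norm] at hv
      calc _ = ENNReal.ofReal (Real.exp (sMax (Matrix.of Z) ^ 2 / 36))
            * volume (Metric.closedBall u (1 / 2)) := by
            rw [Measure.addHaar_closedBall_center volume u]
        _ = ∫⁻ _ in Metric.closedBall u (1 / 2),
            ENNReal.ofReal (Real.exp (sMax (Matrix.of Z) ^ 2 / 36)) := (setLIntegral_const _ _).symm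
        _ ≤ ∫⁻ v in Metric.closedBall u (1 / 2), ENNReal.ofReal (Real.exp
            (-(-(1 / 9)) * ‖Matrix.toEuclideanLin (Matrix.of Z) v‖ ^ 2)) := by
            refine setLIntegral_mono' Metric.isClosed_closedBall.measurableSet fun v hv => ?_
            refine ENNReal.ofReal_le_ofReal (Real.exp_le_exp.2 ?_)
            have h1 := norm_le_sMax_mul (Matrix.of Z) (v - u)
            have h2 := norm_sub_norm_le (Matrix.toEuclideanLin (Matrix.of Z) u)
              (Matrix.toEuclideanLin (Matrix.of Z) (u - v))
            rw [← map_sub, sub_sub_cancel, hu2, ← norm_neg, ← map_neg, neg_sub] at h2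
            have h3 := mul_le_mul_of_nonneg_left (hmem v hv) (sMax_nonneg (Matrix.of Z))
            have h4 : sMax (Matrix.of Z) / 2 ≤ ‖Matrix.toEuclideanLin (Matrix.of Z) v‖ := by
              linarith
            have h5 := pow_le_pow_left₀ (by linarith [sMax_nonneg (Matrix.of Z)]) h4 2
            nlinarith
        _ ≤ _ := by
            refine lintegral_mono_set fun v hv => ?_
            rw [mem_closedBall_zero_iff]
            have := norm_le_insert' v u
            rw [hu] at this
            linarith [hmem v hv]
    · intro u hu
      rw [mem_closedBall_zero_iff] at hu
      have h1 : ‖u‖ ^ 2 ≤ (3 / 2) ^ 2 := by gcongr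
      have h2 : 1 / 2 ≤ 1 + 2 * (-(1 / 9) * ‖u‖ ^ 2) := by linarith
      rw [lintegral_exp_neg_mul_norm_sq m u (by linarith)]
      refine ENNReal.ofReal_le_ofReal (pow_le_pow_left₀ (by positivity) ?_ m)
      rw [inv_le_comm₀ (Real.sqrt_pos.2 (by linarith)) (by norm_num)]
      exact Real.le_sqrt_of_sq_le (by linarith)
  refine h.trans ?_
  calc (3 : ℝ≥0∞) ^ d * ENNReal.ofReal (2 ^ m) ≤ 3 ^ m * ENNReal.ofReal (2 ^ m) := by
        gcongr; norm_num
    _ = ENNReal.ofReal (3 ^ m * 2 ^ m) := by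
        rw [ENNReal.ofReal_mul (by positivity), ENNReal.ofReal_pow (by norm_num : (0 : ℝ) ≤ 3)]
        norm_num
    _ = _ := by rw [← mul_pow]; norm_num

theorem lintegral_sMax_pow_le {m d : ℕ} (hd : 1 ≤ d) (hdm : d ≤ m) (N : ℕ) :
    ∫⁻ Z, ENNReal.ofReal ((sMax (Matrix.of Z) / √m) ^ (2 * N)) ∂(stdGaussianMatrix m d)
      ≤ ENNReal.ofReal (12 * 36 ^ N * N.factorial) := by
  have hm : 1 ≤ m := hd.trans hdm
  have hm0 : (0 : ℝ) < m := by exact_mod_cast hm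
  have hpt : ∀ Z : Fin m → Fin d → ℝ, (sMax (Matrix.of Z) / √m) ^ (2 * N)
      ≤ 6 * 36 ^ N * N.factorial * (1 + Real.exp (sMax (Matrix.of Z) ^ 2 / 36) * (6 ^ m)⁻¹) := by
    intro Z
    set L := sMax (Matrix.of Z)
    set x := L ^ 2 / 36 / m with hx
    have hx0 : 0 ≤ x := by positivity
    have h1 : (L / √m) ^ (2 * N) = 36 ^ N * x ^ N := by
      rw [pow_mul, div_pow, Real.sq_sqrt hm0.le, ← mul_pow, hx]
      congr 1; field_simp
    have h2 : x ^ N ≤ N.factorial * Real.exp x := by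
      have := Real.pow_div_factorial_le_exp x hx0 N
      rwa [div_le_iff₀' (by positivity)] at this
    -- `e ≤ 1 + e ^ m` for `e = exp x / 6`
    have h3 : Real.exp x ≤ 6 * (1 + Real.exp (L ^ 2 / 36) * (6 ^ m)⁻¹) := by
      have h4 : Real.exp (L ^ 2 / 36) * (6 ^ m)⁻¹ = (Real.exp x / 6) ^ m := by
        rw [div_pow, ← Real.exp_nat_mul, div_eq_mul_inv]
        congr 2
        rw [hx]; field_simp
      rw [h4]
      have h5 : Real.exp x / 6 ≤ 1 + (Real.exp x / 6) ^ m := by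
        rcases le_total (Real.exp x / 6) 1 with h | h
        · have : 0 ≤ (Real.exp x / 6) ^ m := by positivity
          linarith
        · linarith [le_self_pow₀ h (by omega : m ≠ 0)]
      linarith
    rw [h1]
    calc _ ≤ 36 ^ N * (N.factorial * (6 * (1 + Real.exp (L ^ 2 / 36) * (6 ^ m)⁻¹))) := by
          gcongr; exact h2.trans (by gcongr)
      _ = _ := by ring
  calc _ ≤ ∫⁻ Z, ENNReal.ofReal (6 * 36 ^ N * N.factorial) *
        (1 + ENNReal.ofReal (Real.exp (sMax (Matrix.of Z) ^ 2 / 36)) * ENNReal.ofReal ((6 ^ m)⁻¹))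
        ∂(stdGaussianMatrix m d) := by
        refine lintegral_mono fun Z => (ENNReal.ofReal_le_ofReal (hpt Z)).trans (le_of_eq ?_)
        rw [ENNReal.ofReal_mul (by positivity), ENNReal.ofReal_add (by positivity) (by positivity),
          ENNReal.ofReal_mul (Real.exp_nonneg _), ENNReal.ofReal_one]
    _ = ENNReal.ofReal (6 * 36 ^ N * N.factorial) *
        (1 + (∫⁻ Z, ENNReal.ofReal (Real.exp (sMax (Matrix.of Z) ^ 2 / 36))
          ∂(stdGaussianMatrix m d)) * ENNReal.ofReal ((6 ^ m)⁻¹)) := by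
        rw [lintegral_const_mul' _ _ ENNReal.ofReal_ne_top, lintegral_add_left measurable_const,
          lintegral_mul_const' _ _ ENNReal.ofReal_ne_top]
        simp
    _ ≤ ENNReal.ofReal (6 * 36 ^ N * N.factorial) *
        (1 + ENNReal.ofReal (6 ^ m) * ENNReal.ofReal ((6 ^ m)⁻¹)) := by
        gcongr; exact lintegral_exp_sMax_sq_le hd hdm
    _ = _ := by
        rw [← ENNReal.ofReal_mul (by positivity), mul_inv_cancel₀ (by positivity),
          ← ENNReal.ofReal_one, ← ENNReal.ofReal_add (by norm_num) (by norm_num),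
          ← ENNReal.ofReal_mul (by positivity)]
        congr 1; ring

/-- Interpolation: with `w = y⁻ᵃ κ^{b - a}` and `Y = κ y`, the power `κ ^ r` is a geometric mean
of `w` and of a power of `Y`, with a weight `θ < 1` on `w`. -/
theorem rpow_le_interpolation {κ y Y w a b r B : ℝ} {N : ℕ} (hκ : 0 < κ) (hy : 0 < y)
    (hY : Y = κ * y) (hr : 0 < r) (hrb : r < b) (ha : 0 < a) (hB : 0 < B)
    (hw : w = y⁻¹ ^ a * κ ^ (b - a)) (hN : a * r / (b - r) ≤ (2 * N : ℕ)) :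
    κ ^ r ≤ B ^ (r / b) * (w / B + (1 + Y ^ (2 * N))) := by
  have hb : 0 < b := hr.trans hrb
  have hbr : 0 < b - r := sub_pos.2 hrb
  have hYpos : 0 < Y := by rw [hY]; positivity
  have hwpos : 0 < w := by rw [hw]; positivity
  set θ := r / b with hθ
  have hθ0 : 0 < θ := by positivity
  have hθ1 : 0 < 1 - θ := by rw [hθ, sub_pos, div_lt_one hb]; exact hrb
  set q := a * r / (b - r) with hq
  have hq0 : 0 ≤ q := by positivity
  have h1 : κ ^ b = w * Y ^ a := by
    rw [hw, hY, Real.mul_rpow hκ.le hy.le, Real.rpow_sub hκ, Real.inv_rpow hy.le]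
    field_simp
  have h2 : κ ^ r = (κ ^ b) ^ θ := by
    rw [← Real.rpow_mul hκ.le, hθ, mul_div_cancel₀ _ hb.ne']
  have h3 : (Y ^ a) ^ θ = (Y ^ q) ^ (1 - θ) := by
    rw [← Real.rpow_mul hYpos.le, ← Real.rpow_mul hYpos.le]
    congr 1
    rw [hq, hθ]; field_simp
  have h4 : Y ^ q ≤ 1 + Y ^ (2 * N) := by
    rcases le_total Y 1 with h | h
    · have := Real.rpow_le_one hYpos.le h hq0
      have : 0 ≤ Y ^ (2 * N) := by positivity
      linarith
    · have := Real.rpow_le_rpow_of_exponent_le h hN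
      rw [Real.rpow_natCast] at this
      linarith
  have h5 : κ ^ r = B ^ θ * ((w / B) ^ θ * (Y ^ q) ^ (1 - θ)) := by
    rw [h2, h1, Real.mul_rpow hwpos.le (by positivity), h3, Real.div_rpow hwpos.le hB.le]
    field_simp
  have h6 := Real.geom_mean_le_arith_mean2_weighted hθ0.le hθ1.le
    (by positivity : 0 ≤ w / B) (by positivity : 0 ≤ Y ^ q) (by ring)
  have h7 : θ * (w / B) ≤ w / B := mul_le_of_le_one_left (by positivity) (by linarith)
  have h8 : (1 - θ) * Y ^ q ≤ Y ^ q := mul_le_of_le_one_left (by positivity) (by linarith)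
  rw [h5]
  gcongr
  linarith

/-- The moments of the condition number with its denominator truncated at `η`, bounded
independently of `η`. The exponent `a` is a free parameter of the interpolation. -/
theorem lintegral_rpow_sMax_div_max_le {m d : ℕ} (hd : 1 ≤ d) (hdm : d ≤ m) {r a η : ℝ} {N : ℕ}
    (hr : 0 < r) (hra : r < a - d + 1) (ham : a < m) (hN : a * r / (a - d + 1 - r) ≤ (2 * N : ℕ))
    (hη : 0 < η) :
    ∫⁻ Z, ENNReal.ofReal ((sMax (Matrix.of Z) / max (sMin (Matrix.of Z)) η) ^ r)
        ∂(stdGaussianMatrix m d)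
      ≤ ENNReal.ofReal (1 + (2 ^ a * (3 ^ d * (1 + 4 ^ m * (a / (m - a))))) ^ (r / (a - d + 1))
        * (2 + 12 * 36 ^ N * N.factorial)) := by
  have hd1 : (1 : ℝ) ≤ d := by exact_mod_cast hd
  have hm0 : (0 : ℝ) < m := by have : (d : ℝ) ≤ m := by exact_mod_cast hdm
                               linarith
  have ha : 0 < a := by linarith
  have hma := sub_pos.2 ham
  have hb : 0 < a - d + 1 := by linarith
  set A : ℝ := 3 ^ d * (1 + 4 ^ m * (a / (m - a))) with hA
  have hA0 : 0 < A := by positivity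
  set C : ℝ := (2 ^ a * A) ^ (r / (a - d + 1)) with hC
  have hC0 : 0 < C := by positivity
  let w : (Fin m → Fin d → ℝ) → ℝ := fun Z => (√m / (2 * max (sMin (Matrix.of Z)) η)) ^ a
        * (min 1 (max (sMin (Matrix.of Z)) η / sMax (Matrix.of Z))) ^ (d - 1)
  have hw0 : ∀ Z, 0 ≤ w Z := fun Z => by
    have := sMax_nonneg (Matrix.of Z)
    have : 0 < max (sMin (Matrix.of Z)) η := lt_max_of_lt_right hη
    simp only [w]; positivity
  have hpt : ∀ Z, (sMax (Matrix.of Z) / max (sMin (Matrix.of Z)) η) ^ r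
      ≤ 1 + C * (w Z * A⁻¹ + (1 + (sMax (Matrix.of Z) / √m) ^ (2 * N))) := by
    intro Z
    set s := max (sMin (Matrix.of Z)) η with hs
    set L := sMax (Matrix.of Z) with hL
    have hs0 : 0 < s := lt_max_of_lt_right hη
    have hL0 : 0 ≤ L := sMax_nonneg _
    have hrest : 0 ≤ w Z * A⁻¹ + (1 + (L / √m) ^ (2 * N)) := by
      have := hw0 Z
      positivity
    rcases le_total (L / s) 1 with h | h
    · -- the truncated condition number may be below one; the bound is then trivial
      have h1 := Real.rpow_le_one (by positivity) h hr.le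
      have : 0 ≤ C * (w Z * A⁻¹ + (1 + (L / √m) ^ (2 * N))) := mul_nonneg hC0.le hrest
      linarith
    · have hL1 : 0 < L := hs0.trans_le ((one_le_div hs0).1 h)
      have h1 := rpow_le_interpolation (κ := L / s) (y := s / √m) (Y := L / √m)
        (w := 2 ^ a * w Z) (a := a) (b := a - d + 1) (r := r) (B := 2 ^ a * A) (N := N)
        (by positivity) (by positivity) (by field_simp) hr hra ha (by positivity) (by
          have h2 : min 1 (s / L) = s / L := min_eq_right ((div_le_one hL1).2 ((one_le_div hs0).1 h))
          have h3 : (L / s) ^ (a - d + 1 - a) = (s / L) ^ (d - 1) := by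
            rw [show a - d + 1 - a = -((d - 1 : ℕ) : ℝ) by push_cast [hd]; ring,
              Real.rpow_neg (by positivity), Real.rpow_natCast, ← inv_pow, inv_div]
          simp only [w]
          rw [h3, ← hs, ← hL, h2, ← mul_assoc, ← Real.mul_rpow (by norm_num) (by positivity)]
          congr 2
          field_simp) hN
      have h4 : 2 ^ a * w Z / (2 ^ a * A) = w Z * A⁻¹ := by
        have : (0 : ℝ) < 2 ^ a := by positivity
        field_simp
      rw [h4] at h1
      linarith
  calc _ ≤ ∫⁻ Z, (1 + ENNReal.ofReal C * (ENNReal.ofReal (w Z) * ENNReal.ofReal A⁻¹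
        + (1 + ENNReal.ofReal ((sMax (Matrix.of Z) / √m) ^ (2 * N))))) ∂(stdGaussianMatrix m d) := by
        refine lintegral_mono fun Z => (ENNReal.ofReal_le_ofReal (hpt Z)).trans (le_of_eq ?_)
        have h0 := hw0 Z
        have h1 : 0 ≤ (sMax (Matrix.of Z) / √m) ^ (2 * N) := by
          have := sMax_nonneg (Matrix.of Z); positivity
        rw [ENNReal.ofReal_add zero_le_one (by positivity), ENNReal.ofReal_mul hC0.le,
          ENNReal.ofReal_add (by positivity) (by positivity), ENNReal.ofReal_mul h0,
          ENNReal.ofReal_add zero_le_one h1, ENNReal.ofReal_one]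
    _ = 1 + ENNReal.ofReal C * ((∫⁻ Z, ENNReal.ofReal (w Z) ∂(stdGaussianMatrix m d))
          * ENNReal.ofReal A⁻¹ + (1 + ∫⁻ Z, ENNReal.ofReal ((sMax (Matrix.of Z) / √m) ^ (2 * N))
            ∂(stdGaussianMatrix m d))) := by
        have hms := measurable_sMax_of (n := m) hd
        rw [lintegral_add_left measurable_const, lintegral_const_mul' _ _ ENNReal.ofReal_ne_top,
          lintegral_add_right _ (by fun_prop), lintegral_mul_const' _ _ ENNReal.ofReal_ne_top,
          lintegral_add_left measurable_const]
        simp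
    _ ≤ 1 + ENNReal.ofReal C * (ENNReal.ofReal A * ENNReal.ofReal A⁻¹
          + (1 + ENNReal.ofReal (12 * 36 ^ N * N.factorial))) := by
        gcongr
        · exact lintegral_rpow_mul_pow_le hd hdm ha ham hη
        · exact lintegral_sMax_pow_le hd hdm N
    _ = _ := by
        rw [← ENNReal.ofReal_mul hA0.le, mul_inv_cancel₀ hA0.ne', ← ENNReal.ofReal_one,
          ← ENNReal.ofReal_add (by positivity) (by positivity),
          ← ENNReal.ofReal_add (by positivity) (by positivity),
          ← ENNReal.ofReal_mul hC0.le, ← ENNReal.ofReal_add (by positivity) (by positivity)]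
        congr 1; ring

/-- The truncation is removed by Fatou's lemma, which also covers the singular matrices. -/
theorem lintegral_condNumber_rpow_le {m d : ℕ} (hd : 1 ≤ d) (hdm : d ≤ m) {r a : ℝ} {N : ℕ}
    (hr : 0 < r) (hra : r < a - d + 1) (ham : a < m)
    (hN : a * r / (a - d + 1 - r) ≤ (2 * N : ℕ)) :
    ∫⁻ Z, condNumber (Matrix.of Z) ^ r ∂(stdGaussianMatrix m d)
      ≤ ENNReal.ofReal (1 + (2 ^ a * (3 ^ d * (1 + 4 ^ m * (a / (m - a))))) ^ (r / (a - d + 1))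
        * (2 + 12 * 36 ^ N * N.factorial)) := by
  let η : ℕ → ℝ := fun k => 1 / ((k : ℝ) + 1)
  have hη : ∀ k, 0 < η k := fun k => by simp only [η]; positivity
  let f : ℕ → (Fin m → Fin d → ℝ) → ℝ≥0∞ := fun k Z =>
    ENNReal.ofReal ((sMax (Matrix.of Z) / max (sMin (Matrix.of Z)) (η k)) ^ r)
  have hf : ∀ k, Measurable (f k) := fun k =>
    (((measurable_sMax_of hd).div ((measurable_sMin_of (hd.trans hdm) hd).max
      measurable_const)).pow_const r).ennreal_ofReal
  have hlim : ∀ Z, Tendsto (fun k => f k Z) atTop (𝓝 (condNumber (Matrix.of Z) ^ r)) := by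
    intro Z
    have h1 : Tendsto (fun k => max (sMin (Matrix.of Z)) (η k)) atTop (𝓝 (sMin (Matrix.of Z))) := by
      have := (tendsto_const_nhds (x := sMin (Matrix.of Z))).max
        (tendsto_one_div_add_atTop_nhds_zero_nat (𝕜 := ℝ))
      rwa [max_eq_left (sMin_nonneg _)] at this
    have h2 := ENNReal.Tendsto.const_div (ENNReal.tendsto_ofReal h1)
      (a := ENNReal.ofReal (sMax (Matrix.of Z))) (Or.inr ENNReal.ofReal_ne_top)
    refine (((ENNReal.continuous_rpow_const (y := r)).tendsto _).comp h2).congr fun k => ?_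
    have hpos : 0 < max (sMin (Matrix.of Z)) (η k) := lt_max_of_lt_right (hη k)
    simp only [Function.comp, f]
    rw [← ENNReal.ofReal_div_of_pos hpos, ENNReal.ofReal_rpow_of_nonneg
      (div_nonneg (sMax_nonneg _) hpos.le) hr.le]
  calc _ = ∫⁻ Z, liminf (fun k => f k Z) atTop ∂(stdGaussianMatrix m d) := by
        simp_rw [fun Z => (hlim Z).liminf_eq]
    _ ≤ liminf (fun k => ∫⁻ Z, f k Z ∂(stdGaussianMatrix m d)) atTop := lintegral_liminf_le hf
    _ ≤ _ := by
        refine liminf_le_of_le (by isBoundedDefault) fun b hb => ?_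
        obtain ⟨k, hk⟩ := hb.exists
        exact hk.trans (lintegral_rpow_sMax_div_max_le hd hdm hr hra ham hN (hη k))

/-- For a fixed size, the moments are finite in the full range `r < m - d + 1`. -/
theorem exists_lintegral_condNumber_rpow_le {m d : ℕ} (hd : 1 ≤ d) (hdm : d ≤ m) {r : ℝ}
    (hr : 0 < r) (hrm : r < (m : ℝ) - d + 1) :
    ∃ K : ℝ, 0 < K ∧
      ∫⁻ Z, condNumber (Matrix.of Z) ^ r ∂(stdGaussianMatrix m d) ≤ ENNReal.ofReal K := by
  obtain ⟨a, ha1, ha2⟩ := exists_between (show r + d - 1 < m by linarith)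
  obtain ⟨N, hN⟩ := exists_nat_ge (a * r / (a - d + 1 - r))
  refine ⟨_, ?_, lintegral_condNumber_rpow_le hd hdm hr (by linarith) ha2 (N := N)
    (hN.trans (by push_cast; linarith [Nat.cast_nonneg (α := ℝ) N]))⟩
  have hd1 : (1 : ℝ) ≤ d := by exact_mod_cast hd
  have := sub_pos.2 ha2
  have : 0 < a := by linarith
  positivity

/-- The bound is uniform as long as the aspect ratio stays away from one: `m ≤ C (m - d + 1)`. -/
theorem exists_lintegral_condNumber_rpow_le_uniform {C r : ℝ} (hC : 0 < C) (hr : 0 < r) :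
    ∃ K : ℝ, 0 < K ∧ ∀ m d : ℕ, 1 ≤ d → d ≤ m → (m : ℝ) ≤ C * ((m : ℝ) - d + 1) →
      4 * r ≤ (m : ℝ) - d + 1 → 2 ≤ (m : ℝ) - d + 1 →
      ∫⁻ Z, condNumber (Matrix.of Z) ^ r ∂(stdGaussianMatrix m d) ≤ ENNReal.ofReal K := by
  obtain ⟨N, hN⟩ := exists_nat_ge (4 * r * C)
  refine ⟨1 + (2 * (3 * (4 * (1 + 2 * C)))) ^ (2 * r * C) * (2 + 12 * 36 ^ N * N.factorial),
    by positivity, fun m d hd hdm hmC hr4 h2 => ?_⟩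
  have hd1 : (1 : ℝ) ≤ d := by exact_mod_cast hd
  have hdm' : (d : ℝ) ≤ m := by exact_mod_cast hdm
  -- `a` is halfway between `d - 1` and `m`, so that both gaps are proportional to `m`
  set b : ℝ := ((m : ℝ) - d + 1) / 2 with hb
  have hb0 : 0 < b := by linarith
  set a : ℝ := ((m : ℝ) + d - 1) / 2 with ha
  have hab : a - d + 1 = b := by rw [ha, hb]; ring
  have hma : (m : ℝ) - a = b := by rw [ha, hb]; ring
  have ha0 : 0 < a := by linarith
  have ham : a ≤ m := by linarith
  have hmb : (m : ℝ) ≤ 2 * C * b := by rw [hb]; linarith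
  have hm1 : 1 ≤ m := hd.trans hdm
  refine (lintegral_condNumber_rpow_le hd hdm (a := a) (N := N) hr (by linarith) (by linarith)
    ?_).trans (ENNReal.ofReal_le_ofReal ?_)
  · rw [hab]
    refine le_trans ?_ (hN.trans (by push_cast; linarith [Nat.cast_nonneg (α := ℝ) N]))
    rw [div_le_iff₀ (by linarith)]
    calc a * r ≤ (2 * C * b) * r := by gcongr; linarith
      _ ≤ (2 * C * (2 * (b - r))) * r := by gcongr; linarith
      _ = _ := by ring
  · rw [hab, hma]
    have h1 : a / b ≤ 2 * C := by rw [div_le_iff₀ hb0]; linarith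
    have h3 : (1 : ℝ) + 4 ^ m * (a / b) ≤ (4 * (1 + 2 * C)) ^ m := by
      have h4 : 1 + 2 * C ≤ (1 + 2 * C) ^ m := le_self_pow₀ (by linarith) (by omega)
      have h5 : (1 : ℝ) ≤ 4 ^ m := one_le_pow₀ (by norm_num)
      calc (1 : ℝ) + 4 ^ m * (a / b) ≤ 4 ^ m * 1 + 4 ^ m * (2 * C) := by
            gcongr; linarith
        _ = 4 ^ m * (1 + 2 * C) := by ring
        _ ≤ 4 ^ m * (1 + 2 * C) ^ m := by gcongr
        _ = _ := (mul_pow _ _ _).symm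
    have h6 : (2 : ℝ) ^ a * (3 ^ d * (1 + 4 ^ m * (a / b)))
        ≤ (2 * (3 * (4 * (1 + 2 * C)))) ^ m := by
      rw [mul_pow, mul_pow 3]
      have h7 : (2 : ℝ) ^ a ≤ 2 ^ m := by
        rw [← Real.rpow_natCast]
        exact Real.rpow_le_rpow_of_exponent_le (by norm_num) ham
      have h8 : (3 : ℝ) ^ d ≤ 3 ^ m := pow_le_pow_right₀ (by norm_num) hdm
      gcongr
    have h9 : (2 ^ a * (3 ^ d * (1 + 4 ^ m * (a / b)))) ^ (r / b)
        ≤ (2 * (3 * (4 * (1 + 2 * C)))) ^ (2 * r * C) := by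
      calc _ ≤ ((2 * (3 * (4 * (1 + 2 * C)))) ^ m) ^ (r / b) := by gcongr
        _ = (2 * (3 * (4 * (1 + 2 * C)))) ^ (m * (r / b)) := by
            rw [← Real.rpow_natCast, ← Real.rpow_mul (by positivity)]
        _ ≤ _ := by
            refine Real.rpow_le_rpow_of_exponent_le (by linarith) ?_
            rw [← mul_div_assoc, div_le_iff₀ hb0]
            nlinarith
    gcongr

/-! ### The smallest singular value near the critical regime -/

theorem lintegral_sum_mul_sq {d : ℕ} (u : EuclideanSpace ℝ (Fin d)) :
    ∫⁻ x, ENNReal.ofReal ((∑ j, x j * u j) ^ 2) ∂(Measure.pi fun _ : Fin d => gaussianReal 0 1)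
      = ENNReal.ofReal (‖u‖ ^ 2) := by
  have h1 : ∫⁻ x, ENNReal.ofReal ((∑ j, x j * u j) ^ 2)
        ∂(Measure.pi fun _ : Fin d => gaussianReal 0 1)
      = ∫⁻ y, ENNReal.ofReal (y ^ 2)
        ∂((Measure.pi fun _ : Fin d => gaussianReal 0 1).map (fun x => ∑ j, x j * u j)) := by
    rw [lintegral_map (by fun_prop) (by fun_prop)]
  have hmem : MemLp (fun x : ℝ => x) 2 (gaussianReal 0 1) := memLp_id_gaussianReal 2
  have h2 : ∫⁻ y, ENNReal.ofReal (y ^ 2) ∂(gaussianReal 0 1) = 1 := by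
    rw [← ofReal_integral_eq_lintegral_ofReal hmem.integrable_sq
      (ae_of_all _ fun x => sq_nonneg x)]
    have h3 : ∫ x, x ^ 2 ∂(gaussianReal 0 1) = Var[id; gaussianReal 0 1] := by
      rw [variance_of_integral_eq_zero aemeasurable_id (by simp)]
      rfl
    rw [h3, variance_id_gaussianReal]; simp
  rw [h1, map_pi_gaussianReal_sum_mul, lintegral_map (by fun_prop) (by fun_prop)]
  simp_rw [mul_pow]
  simp_rw [fun y : ℝ => ENNReal.ofReal_mul (q := y ^ 2) (sq_nonneg ‖u‖)]
  rw [lintegral_const_mul' _ _ ENNReal.ofReal_ne_top, h2, mul_one]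

/-- Test the matrix on a unit vector orthogonal to its first `d - 1` rows: the remaining
`m - d + 1` rows are independent of that vector. -/
theorem lintegral_sMin_sq_le {m d : ℕ} (hd : 1 ≤ d) (hdm : d ≤ m) :
    ∫⁻ Z, ENNReal.ofReal (sMin (Matrix.of Z) ^ 2) ∂(stdGaussianMatrix m d)
      ≤ ((m - d + 1 : ℕ) : ℝ≥0∞) := by
  have hm : 1 ≤ m := hd.trans hdm
  let pr : Fin m → Prop := fun i => i.val < d - 1
  let ν : Measure (Fin d → ℝ) := Measure.pi fun _ => gaussianReal 0 1
  have hmp := (measurePreserving_piEquivPiSubtypeProd (fun _ : Fin m => ν) pr).symm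
  have hmeas : Measurable fun Z : Fin m → Fin d → ℝ => ENNReal.ofReal (sMin (Matrix.of Z) ^ 2) :=
    ((measurable_sMin_of hm hd).pow_const 2).ennreal_ofReal
  have hcard : Fintype.card {i : Fin m // ¬ pr i} = m - d + 1 := by
    rw [Fintype.card_subtype_compl, Fintype.card_fin, Fintype.card_subtype]
    have : (Finset.univ.filter fun i : Fin m => pr i).card = d - 1 := by
      simp only [pr]
      rw [Fin.card_filter_val_lt]; omega
    rw [this]; omega
  have hcard' : Fintype.card {i : Fin m // pr i} < d := by
    have h1 := Fintype.card_subtype_compl pr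
    have h2 : Fintype.card {i : Fin m // pr i} ≤ Fintype.card (Fin m) :=
      Fintype.card_subtype_le _
    rw [Fintype.card_fin] at h1 h2
    rw [hcard] at h1
    omega
  rw [stdGaussianMatrix, ← hmp.lintegral_comp hmeas]
  refine (lintegral_prod_le _).trans ?_
  have hinner : ∀ y : {i : Fin m // pr i} → Fin d → ℝ,
      ∫⁻ z : {i : Fin m // ¬ pr i} → Fin d → ℝ, ENNReal.ofReal (sMin (Matrix.of
        ((MeasurableEquiv.piEquivPiSubtypeProd (fun _ : Fin m => Fin d → ℝ) pr).symm (y, z))) ^ 2)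
        ∂(Measure.pi fun _ => ν) ≤ ((m - d + 1 : ℕ) : ℝ≥0∞) := by
    intro y
    obtain ⟨u, hu1, hu2⟩ : ∃ u : EuclideanSpace ℝ (Fin d), ‖u‖ = 1 ∧
        ∀ i : {i : Fin m // pr i}, ∑ j, y i j * u j = 0 := by
      let φ : EuclideanSpace ℝ (Fin d) →ₗ[ℝ] ({i : Fin m // pr i} → ℝ) :=
        (Matrix.mulVecLin (Matrix.of y)) ∘ₗ
          (WithLp.linearEquiv 2 ℝ (Fin d → ℝ)).toLinearMap
      have hker : LinearMap.ker φ ≠ ⊥ := LinearMap.ker_ne_bot_of_finrank_lt (by simpa using hcard')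
      obtain ⟨v, hv, hv0⟩ := Submodule.exists_mem_ne_zero_of_ne_bot hker
      refine ⟨‖v‖⁻¹ • v, norm_smul_inv_norm hv0, fun i => ?_⟩
      have h1 : φ (‖v‖⁻¹ • v) = 0 := by rw [map_smul, LinearMap.mem_ker.1 hv, smul_zero]
      exact congrFun h1 i
    have hle : ∀ z : {i : Fin m // ¬ pr i} → Fin d → ℝ, sMin (Matrix.of
        ((MeasurableEquiv.piEquivPiSubtypeProd (fun _ : Fin m => Fin d → ℝ) pr).symm (y, z))) ^ 2
        ≤ ∑ i, (∑ j, z i j * u j) ^ 2 := by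
      intro z
      set Z := (MeasurableEquiv.piEquivPiSubtypeProd (fun _ : Fin m => Fin d → ℝ) pr).symm (y, z)
        with hZ
      have hZ1 : ∀ i : {i : Fin m // pr i}, Z i = y i := fun i => by
        simp [hZ, MeasurableEquiv.piEquivPiSubtypeProd, Equiv.piEquivPiSubtypeProd, i.2]
      have hZ2 : ∀ i : {i : Fin m // ¬ pr i}, Z i = z i := fun i => by
        simp [hZ, MeasurableEquiv.piEquivPiSubtypeProd, Equiv.piEquivPiSubtypeProd, i.2]
      have h1 := sMin_mul_norm_le hdm (Matrix.of Z) u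
      rw [hu1, mul_one] at h1
      refine (pow_le_pow_left₀ (sMin_nonneg _) h1 2).trans (le_of_eq ?_)
      rw [norm_sq_toEuclideanLin_of, ← Fintype.sum_subtype_add_sum_subtype pr]
      simp_rw [hZ1, hZ2, hu2]
      simp
    calc _ ≤ ∫⁻ z : {i : Fin m // ¬ pr i} → Fin d → ℝ,
            ∑ i, ENNReal.ofReal ((∑ j, z i j * u j) ^ 2) ∂(Measure.pi fun _ => ν) := by
          refine lintegral_mono fun z => ?_
          rw [← ENNReal.ofReal_sum_of_nonneg fun i _ => sq_nonneg _]
          exact ENNReal.ofReal_le_ofReal (hle z)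
      _ = ∑ i : {i : Fin m // ¬ pr i}, 1 := by
          rw [lintegral_finsetSum _ (fun i _ => by fun_prop)]
          refine Finset.sum_congr rfl fun i _ => ?_
          have h1 := (measurePreserving_eval (fun _ : {i : Fin m // ¬ pr i} => ν) i).lintegral_comp
            (f := fun x => ENNReal.ofReal ((∑ j, x j * u j) ^ 2)) (by fun_prop)
          simp only [Function.eval] at h1
          rw [h1, lintegral_sum_mul_sq, hu1]; simp
      _ = _ := by
          rw [Finset.sum_const, Finset.card_univ, hcard]; simp
  calc _ ≤ ∫⁻ _ : {i : Fin m // pr i} → Fin d → ℝ, ((m - d + 1 : ℕ) : ℝ≥0∞)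
        ∂(Measure.pi fun _ => ν) := lintegral_mono hinner
    _ = _ := by simp

/-- Markov's inequality for `sMin ^ 2`, and the small ball estimate for the first column, which
bounds `sMax` from below. -/
theorem le_lintegral_condNumber_rpow {m d : ℕ} (hd : 1 ≤ d) (hdm : d ≤ m) {r ε : ℝ} (hr : 0 < r)
    (hε : 0 < ε) :
    ENNReal.ofReal ((1 / (8 * √ε)) ^ r)
        * (1 - (ENNReal.ofReal (((m - d + 1 : ℕ) : ℝ) / (ε * m)) + ENNReal.ofReal ((1 / 2) ^ m)))
      ≤ ∫⁻ Z, condNumber (Matrix.of Z) ^ r ∂(stdGaussianMatrix m d) := by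
  have hm : 1 ≤ m := hd.trans hdm
  have hm0 : (0 : ℝ) < m := by exact_mod_cast hm
  set G := stdGaussianMatrix m d
  let u : EuclideanSpace ℝ (Fin d) := EuclideanSpace.single ⟨0, hd⟩ 1
  have hu : ‖u‖ = 1 := by simp [u]
  let B₁ : Set (Fin m → Fin d → ℝ) := {Z | ENNReal.ofReal (ε * m)
    ≤ ENNReal.ofReal (sMin (Matrix.of Z) ^ 2)}
  let B₂ : Set (Fin m → Fin d → ℝ) := {Z | ‖Matrix.toEuclideanLin (Matrix.of Z) u‖ ≤ 1 / 8 * √m}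
  have hmeas : Measurable fun Z : Fin m → Fin d → ℝ => ENNReal.ofReal (sMin (Matrix.of Z) ^ 2) :=
    ((measurable_sMin_of hm hd).pow_const 2).ennreal_ofReal
  have hB₁m : MeasurableSet B₁ := measurableSet_le measurable_const hmeas
  have hB₂m : MeasurableSet B₂ :=
    measurableSet_le (measurable_norm_toEuclideanLin_of u) measurable_const
  have hB₁ : G B₁ ≤ ENNReal.ofReal (((m - d + 1 : ℕ) : ℝ) / (ε * m)) := by
    have h1 := (mul_meas_ge_le_lintegral₀ (μ := G) hmeas.aemeasurable
      (ENNReal.ofReal (ε * m))).trans (lintegral_sMin_sq_le hd hdm)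
    rw [ENNReal.ofReal_div_of_pos (by positivity), ENNReal.ofReal_natCast,
      ENNReal.le_div_iff_mul_le (Or.inl (by simp; positivity)) (Or.inl ENNReal.ofReal_ne_top),
      mul_comm]
    exact h1
  have hB₂ : G B₂ ≤ ENNReal.ofReal ((1 / 2) ^ m) := by
    have h1 := measure_norm_le_mul_sqrt m (u := u) (by rw [hu]; norm_num)
      (y := 1 / 8) (by norm_num)
    norm_num at h1 ⊢
    exact h1
  have hcompl : 1 - (ENNReal.ofReal (((m - d + 1 : ℕ) : ℝ) / (ε * m))
      + ENNReal.ofReal ((1 / 2) ^ m)) ≤ G (B₁ ∪ B₂)ᶜ := by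
    rw [prob_compl_eq_one_sub (hB₁m.union hB₂m)]
    exact tsub_le_tsub_left ((measure_union_le _ _).trans (add_le_add hB₁ hB₂)) _
  calc _ ≤ ENNReal.ofReal ((1 / (8 * √ε)) ^ r) * G (B₁ ∪ B₂)ᶜ := by gcongr
    _ = ∫⁻ _ in (B₁ ∪ B₂)ᶜ, ENNReal.ofReal ((1 / (8 * √ε)) ^ r) ∂G := (setLIntegral_const _ _).symm
    _ ≤ ∫⁻ Z in (B₁ ∪ B₂)ᶜ, condNumber (Matrix.of Z) ^ r ∂G := by
        refine setLIntegral_mono' (hB₁m.union hB₂m).compl fun Z hZ => ?_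
        simp only [Set.compl_union, Set.mem_inter_iff, Set.mem_compl_iff, B₁, B₂,
          Set.mem_ofPred_eq, not_le] at hZ
        rw [← ENNReal.ofReal_rpow_of_nonneg (by positivity) hr.le]
        refine ENNReal.rpow_le_rpow ?_ hr.le
        have h1 : sMin (Matrix.of Z) ≤ √ε * √m := by
          rw [← Real.sqrt_mul hε.le]
          exact Real.le_sqrt_of_sq_le (ENNReal.ofReal_lt_ofReal_iff_of_nonneg (sq_nonneg _)
            |>.1 hZ.1).le
        have h2 : 1 / 8 * √m ≤ sMax (Matrix.of Z) := by
          have := norm_le_sMax_mul (Matrix.of Z) u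
          rw [hu, mul_one] at this
          exact hZ.2.le.trans this
        have h3 : 1 / (8 * √ε) = (1 / 8 * √m) / (√ε * √m) := by field_simp
        rw [h3, ENNReal.ofReal_div_of_pos (by positivity)]
        exact ENNReal.div_le_div (ENNReal.ofReal_le_ofReal h2) (ENNReal.ofReal_le_ofReal h1)
    _ ≤ _ := setLIntegral_le_lintegral _ _

/-! ### Reduction to standard Gaussian matrices -/

section Reduction

open scoped MatrixOrder

theorem EigenvaluesBetween.inner_toEuclideanLin {a b : ℝ} {p : ℕ} {S : Matrix (Fin p) (Fin p) ℝ}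
    (h : EigenvaluesBetween a b S) (v : EuclideanSpace ℝ (Fin p)) :
    a * ‖v‖ ^ 2 ≤ inner ℝ v (Matrix.toEuclideanLin S v) ∧
      inner ℝ v (Matrix.toEuclideanLin S v) ≤ b * ‖v‖ ^ 2 := by
  obtain ⟨hS, he⟩ := h
  have hsym : (Matrix.toEuclideanLin S).IsSymmetric := Matrix.isSymmetric_toEuclideanLin_iff.2 hS
  have hb : ∀ i, Matrix.toEuclideanLin S (hS.eigenvectorBasis i)
      = hS.eigenvalues i • hS.eigenvectorBasis i := by
    intro i
    have := hS.mulVec_eigenvectorBasis i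
    ext j
    simpa [Matrix.toLpLin_apply] using congrFun this j
  have hsum : inner ℝ v (Matrix.toEuclideanLin S v)
      = ∑ i, hS.eigenvalues i * inner ℝ (hS.eigenvectorBasis i) v ^ 2 := by
    rw [← hS.eigenvectorBasis.sum_inner_mul_inner]
    refine Finset.sum_congr rfl fun i _ => ?_
    rw [← hsym, hb, real_inner_smul_left, real_inner_comm]
    ring
  rw [hsum, ← hS.eigenvectorBasis.sum_sq_inner_right v, Finset.mul_sum, Finset.mul_sum]
  exact ⟨Finset.sum_le_sum fun i _ => mul_le_mul_of_nonneg_right (he i).1 (sq_nonneg _),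
    Finset.sum_le_sum fun i _ => mul_le_mul_of_nonneg_right (he i).2 (sq_nonneg _)⟩

theorem EigenvaluesBetween.posSemidef {a b : ℝ} (ha : 0 < a) {p : ℕ}
    {S : Matrix (Fin p) (Fin p) ℝ} (h : EigenvaluesBetween a b S) : S.PosSemidef := by
  obtain ⟨hS, he⟩ := h
  exact hS.posSemidef_iff_eigenvalues_nonneg.2 fun i => ha.le.trans (he i).1

theorem transpose_sqrt {p : ℕ} (S : Matrix (Fin p) (Fin p) ℝ) :
    (CFC.sqrt S).transpose = CFC.sqrt S := by
  rw [← Matrix.conjTranspose_eq_transpose_of_trivial]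
  exact (CFC.sqrt_nonneg S).isSelfAdjoint

theorem EigenvaluesBetween.norm_sqrt {a b : ℝ} (ha : 0 < a) {p : ℕ}
    {S : Matrix (Fin p) (Fin p) ℝ} (h : EigenvaluesBetween a b S)
    (v : EuclideanSpace ℝ (Fin p)) :
    √a * ‖v‖ ≤ ‖Matrix.toEuclideanLin (CFC.sqrt S) v‖ ∧
      ‖Matrix.toEuclideanLin (CFC.sqrt S) v‖ ≤ √b * ‖v‖ := by
  have h1 : ‖Matrix.toEuclideanLin (CFC.sqrt S) v‖ ^ 2 = inner ℝ v (Matrix.toEuclideanLin S v) := by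
    rw [← real_inner_self_eq_norm_sq, ← LinearMap.adjoint_inner_right,
      ← toEuclideanLin_transpose_eq_adjoint, transpose_sqrt, ← toEuclideanLin_mul_apply,
      CFC.sqrt_mul_sqrt_self _ (h.posSemidef ha).nonneg]
  obtain ⟨h2, h3⟩ := h.inner_toEuclideanLin v
  rw [← h1] at h2 h3
  constructor
  · refine le_of_sq_le_sq ?_ (norm_nonneg _)
    rwa [mul_pow, Real.sq_sqrt ha.le]
  · rw [← Real.sqrt_sq (norm_nonneg v), ← Real.sqrt_mul' _ (sq_nonneg _)]
    exact Real.le_sqrt_of_sq_le h3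

/-- The rows of `Z * √S` are independent with law `𝒩(0, S)` if `Z` is a standard Gaussian
matrix. -/
theorem condMoment_eq_lintegral_stdGaussianMatrix {Ω : Type*} [MeasurableSpace Ω] {n p : ℕ}
    (hn : 1 ≤ n) (hp : 1 ≤ p)
    {X : Ω → Matrix (Fin n) (Fin p) ℝ} {S : Matrix (Fin p) (Fin p) ℝ} {P : Measure Ω}
    [IsProbabilityMeasure P] (h : HasIIDGaussianRows X S P) (r : ℝ) :
    condMoment X P r
      = ∫⁻ Z, condNumber (Matrix.of Z * CFC.sqrt S) ^ r ∂(stdGaussianMatrix n p) := by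
  let F : (Fin n → EuclideanSpace ℝ (Fin p)) → ℝ≥0∞ := fun Y =>
    condNumber (Matrix.of fun i => (Y i).ofLp) ^ r
  have hF : Measurable F :=
    ((measurable_condNumber_of hn hp).comp
      (by fun_prop : Measurable fun (Y : Fin n → EuclideanSpace ℝ (Fin p)) (i : Fin n) =>
        (Y i).ofLp)).pow_const r
  let g : (Fin p → ℝ) → EuclideanSpace ℝ (Fin p) := fun x =>
    0 + Matrix.toEuclideanCLM (𝕜 := ℝ) (CFC.sqrt S) (WithLp.toLp 2 x)
  have hg : Measurable g := by fun_prop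
  have hY : ∀ i, AEMeasurable (fun ω => WithLp.toLp 2 (X ω i)) P := fun i => (h.law i).aemeasurable
  have hlaw : P.map (fun ω (i : Fin n) => WithLp.toLp 2 (X ω i))
      = (stdGaussianMatrix n p).map (fun Z i => g (Z i)) := by
    rw [(iIndepFun_iff_map_fun_eq_pi_map hY).1 h.indep, stdGaussianMatrix,
      Measure.pi_map_pi (hμ := fun i => by
        have := Measure.isProbabilityMeasure_map
          (μ := Measure.pi fun _ : Fin p => gaussianReal 0 1) hg.aemeasurable
        infer_instance) (fun _ => hg.aemeasurable)]
    congr 1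
    ext1 i
    rw [(h.law i).map_eq, multivariateGaussian, ← map_pi_eq_stdGaussian,
      Measure.map_map (by fun_prop) (by fun_prop)]
    rfl
  calc condMoment X P r = ∫⁻ ω, F (fun i => WithLp.toLp 2 (X ω i)) ∂P := rfl
    _ = ∫⁻ Y, F Y ∂(P.map (fun ω (i : Fin n) => WithLp.toLp 2 (X ω i))) :=
        (lintegral_map' hF.aemeasurable (aemeasurable_pi_lambda _ hY)).symm
    _ = ∫⁻ Z, F (fun i => g (Z i)) ∂(stdGaussianMatrix n p) := by
        rw [hlaw, lintegral_map hF (by fun_prop)]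
    _ = _ := by
        refine lintegral_congr fun Z => ?_
        simp only [F, g]
        congr 2
        ext i j
        have hsymm : ∀ k, CFC.sqrt S j k = CFC.sqrt S k j := fun k =>
          congrFun (congrFun (transpose_sqrt S) k) j
        simp [Matrix.mul_apply, Matrix.mulVec, dotProduct, hsymm, mul_comm]

theorem lintegral_condNumber_swap {n p : ℕ} (hn : 1 ≤ n) (hp : 1 ≤ p) (r : ℝ) :
    ∫⁻ Z, condNumber (Matrix.of Z) ^ r ∂(stdGaussianMatrix n p)
      = ∫⁻ Z, condNumber (Matrix.of Z) ^ r ∂(stdGaussianMatrix p n) := by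
  rw [← (measurePreserving_swap_stdGaussianMatrix n p).lintegral_comp
    ((measurable_condNumber_of hp hn).pow_const r)]
  refine lintegral_congr fun Z => ?_
  rw [← condNumber_transpose hn hp]
  rfl

theorem lintegral_condNumber_eq_tall {n p : ℕ} (hn : 1 ≤ n) (hp : 1 ≤ p) (r : ℝ) :
    ∫⁻ Z, condNumber (Matrix.of Z) ^ r ∂(stdGaussianMatrix n p)
      = ∫⁻ Z, condNumber (Matrix.of Z) ^ r ∂(stdGaussianMatrix (max n p) (min n p)) := by
  rcases le_total p n with h | h
  · rw [max_eq_left h, min_eq_right h]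
  · rw [max_eq_right h, min_eq_left h, lintegral_condNumber_swap hn hp]

theorem condMoment_le_mul {Ω : Type*} [MeasurableSpace Ω] {n p : ℕ} (hn : 1 ≤ n) (hp : 1 ≤ p)
    {X : Ω → Matrix (Fin n) (Fin p) ℝ} {S : Matrix (Fin p) (Fin p) ℝ} {P : Measure Ω}
    [IsProbabilityMeasure P] (h : HasIIDGaussianRows X S P) {a b : ℝ} (ha : 0 < a)
    (hS : EigenvaluesBetween a b S) {r : ℝ} (hr : 0 ≤ r) :
    condMoment X P r ≤ ENNReal.ofReal (√b / √a) ^ r *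
      ∫⁻ Z, condNumber (Matrix.of Z) ^ r ∂(stdGaussianMatrix (max n p) (min n p)) := by
  have hb : 0 < b := by
    obtain ⟨_, he⟩ := hS
    exact ha.trans_le ((he ⟨0, hp⟩).1.trans (he ⟨0, hp⟩).2)
  rw [condMoment_eq_lintegral_stdGaussianMatrix hn hp h, ← lintegral_condNumber_eq_tall hn hp,
    ← lintegral_const_mul _ ((measurable_condNumber_of hn hp).pow_const r)]
  refine lintegral_mono fun Z => ?_
  rw [← ENNReal.mul_rpow_of_nonneg _ _ hr]
  exact ENNReal.rpow_le_rpow (condNumber_mul_le hn hp (Real.sqrt_pos.2 ha) (Real.sqrt_pos.2 hb)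
    (transpose_sqrt S) _ (fun v => (hS.norm_sqrt ha v).1) (fun v => (hS.norm_sqrt ha v).2)) hr

theorem le_mul_condMoment {Ω : Type*} [MeasurableSpace Ω] {n p : ℕ} (hn : 1 ≤ n) (hp : 1 ≤ p)
    {X : Ω → Matrix (Fin n) (Fin p) ℝ} {S : Matrix (Fin p) (Fin p) ℝ} {P : Measure Ω}
    [IsProbabilityMeasure P] (h : HasIIDGaussianRows X S P) {a b : ℝ} (ha : 0 < a)
    (hS : EigenvaluesBetween a b S) {r : ℝ} (hr : 0 ≤ r) :
    ∫⁻ Z, condNumber (Matrix.of Z) ^ r ∂(stdGaussianMatrix (max n p) (min n p))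
      ≤ ENNReal.ofReal (√b / √a) ^ r * condMoment X P r := by
  have hb : 0 < b := by
    obtain ⟨_, he⟩ := hS
    exact ha.trans_le ((he ⟨0, hp⟩).1.trans (he ⟨0, hp⟩).2)
  rw [condMoment_eq_lintegral_stdGaussianMatrix hn hp h, ← lintegral_condNumber_eq_tall hn hp,
    ← lintegral_const_mul' _ _ (ENNReal.rpow_ne_top_of_nonneg hr ENNReal.ofReal_ne_top)]
  refine lintegral_mono fun Z => ?_
  rw [← ENNReal.mul_rpow_of_nonneg _ _ hr]
  exact ENNReal.rpow_le_rpow (condNumber_le_mul hn hp (Real.sqrt_pos.2 ha) (Real.sqrt_pos.2 hb)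
    (transpose_sqrt S) _ (fun v => (hS.norm_sqrt ha v).1) (fun v => (hS.norm_sqrt ha v).2)) hr

end Reduction

/-! ### The two asymptotic regimes -/

theorem condMoment_le_ofReal {Ω : Type*} [MeasurableSpace Ω] {n p : ℕ} (hn : 1 ≤ n) (hp : 1 ≤ p)
    {X : Ω → Matrix (Fin n) (Fin p) ℝ} {S : Matrix (Fin p) (Fin p) ℝ} {P : Measure Ω}
    [IsProbabilityMeasure P] (h : HasIIDGaussianRows X S P) {a b : ℝ} (ha : 0 < a)
    (hS : EigenvaluesBetween a b S) {r K K' : ℝ} (hr : 0 ≤ r)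
    (hK : ∫⁻ Z, condNumber (Matrix.of Z) ^ r ∂(stdGaussianMatrix (max n p) (min n p))
      ≤ ENNReal.ofReal K) (hK' : (√b / √a) ^ r * K ≤ K') :
    condMoment X P r ≤ ENNReal.ofReal K' := by
  refine (condMoment_le_mul hn hp h ha hS hr).trans ?_
  calc _ ≤ ENNReal.ofReal (√b / √a) ^ r * ENNReal.ofReal K := by gcongr
    _ = ENNReal.ofReal ((√b / √a) ^ r * K) := by
        rw [ENNReal.ofReal_rpow_of_nonneg (by positivity) hr, ← ENNReal.ofReal_mul (by positivity)]
    _ ≤ _ := ENNReal.ofReal_le_ofReal hK'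

theorem abs_sub_eq_max_sub_min (n p : ℕ) :
    |(p : ℝ) - n| = ((max n p : ℕ) : ℝ) - ((min n p : ℕ) : ℝ) := by
  push_cast
  rw [max_sub_min_eq_abs]

theorem eventually_wide {γ r : ℝ} (hγ : 1 < γ) {p : ℕ → ℕ}
    (hlim : Tendsto (fun n : ℕ => (p n : ℝ) / (n : ℝ)) atTop (𝓝 γ)) :
    ∀ᶠ n : ℕ in atTop, n ≤ p n ∧ (p n : ℝ) ≤ (γ + 1) / (γ - 1) * ((p n : ℝ) - n + 1) ∧
      4 * r ≤ (p n : ℝ) - n + 1 ∧ 2 ≤ (p n : ℝ) - n + 1 := by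
  have hγ1 : 0 < γ - 1 := sub_pos.2 hγ
  have h1 : ∀ᶠ n : ℕ in atTop, (γ + 1) / 2 < (p n : ℝ) / n :=
    hlim.eventually_const_lt (by linarith)
  have h2 : ∀ᶠ n : ℕ in atTop, max (4 * r) 2 ≤ (γ - 1) / 2 * (n : ℝ) :=
    (tendsto_natCast_atTop_atTop.const_mul_atTop (half_pos hγ1)).eventually_ge_atTop _
  filter_upwards [h1, h2, eventually_ge_atTop 1] with n h1 h2 hn
  have hn0 : (0 : ℝ) < n := by exact_mod_cast hn
  rw [lt_div_iff₀ hn0] at h1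
  have h3 : (γ - 1) / 2 * (n : ℝ) ≤ (p n : ℝ) - n := by linarith
  have h4 : (0 : ℝ) < (γ - 1) / 2 * (n : ℝ) := by positivity
  refine ⟨by exact_mod_cast (by linarith : (n : ℝ) ≤ p n), ?_,
    by linarith [le_max_left (4 * r) 2], by linarith [le_max_right (4 * r) 2]⟩
  rw [div_mul_eq_mul_div, le_div_iff₀ hγ1]
  nlinarith

/-- The smallest singular value is `o(√n)` in mean square while the largest one is at least of
order `√n` with probability close to one, whichever of `n` and `p n` is larger. -/
theorem tendsto_lintegral_condNumber_rpow {p : ℕ → ℕ} (hp : ∀ n, 1 ≤ n → 1 ≤ p n)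
    (hlim : Tendsto (fun n : ℕ => (p n : ℝ) / (n : ℝ)) atTop (𝓝 1)) {r : ℝ} (hr : 0 < r) :
    Tendsto (fun n : ℕ => ∫⁻ Z, condNumber (Matrix.of Z) ^ r
      ∂(stdGaussianMatrix (max n (p n)) (min n (p n)))) atTop (𝓝 ∞) := by
  rw [ENNReal.tendsto_nhds_top_iff_nnreal]
  intro B
  -- `ε` is chosen so that `(1 / (8 √ε)) ^ r = 4 (B + 1)`
  set R : ℝ := (4 * ((B : ℝ) + 1)) ^ (1 / r) with hR
  have hR0 : 0 < R := by positivity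
  have hRr : R ^ r = 4 * ((B : ℝ) + 1) := by
    rw [hR, ← Real.rpow_mul (by positivity), one_div_mul_cancel hr.ne', Real.rpow_one]
  set ε : ℝ := (1 / (8 * R)) ^ 2 with hε
  have hε0 : 0 < ε := by positivity
  have hεR : 1 / (8 * √ε) = R := by
    rw [hε, Real.sqrt_sq (by positivity)]; field_simp
  have h1 : Tendsto (fun n : ℕ => ((|(p n : ℝ) / n - 1| + 1 / (n : ℝ)) / ε)) atTop (𝓝 0) := by
    have := (((hlim.sub_const 1).abs).add (tendsto_one_div_atTop_nhds_zero_nat (𝕜 := ℝ))).div_const ε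
    simpa using this
  have h2 : Tendsto (fun n : ℕ => (1 / 2 : ℝ) ^ n) atTop (𝓝 0) :=
    tendsto_pow_atTop_nhds_zero_of_lt_one (by norm_num) (by norm_num)
  filter_upwards [h1.eventually_lt_const (show (0 : ℝ) < 1 / 4 by norm_num),
    h2.eventually_lt_const (show (0 : ℝ) < 1 / 4 by norm_num), eventually_ge_atTop 1]
    with n hn1 hn2 hn
  have hn0 : (0 : ℝ) < n := by exact_mod_cast hn
  set m := max n (p n) with hm
  set d := min n (p n) with hd
  have hd1 : 1 ≤ d := le_min hn (hp n hn)
  have hdm : d ≤ m := min_le_max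
  have hnm : n ≤ m := le_max_left _ _
  have hnm' : (n : ℝ) ≤ m := by exact_mod_cast hnm
  refine lt_of_lt_of_le ?_ (le_lintegral_condNumber_rpow hd1 hdm hr hε0)
  have h3 : ((m - d + 1 : ℕ) : ℝ) / (ε * m) ≤ 1 / 4 := by
    refine le_trans ?_ hn1.le
    have h4 : ((m - d + 1 : ℕ) : ℝ) = |(p n : ℝ) - n| + 1 := by
      rw [abs_sub_eq_max_sub_min, Nat.cast_add, Nat.cast_sub hdm, Nat.cast_one]
    have h5 : |(p n : ℝ) / n - 1| + 1 / (n : ℝ) = (|(p n : ℝ) - n| + 1) / n := by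
      rw [add_div, ← abs_of_pos hn0, ← abs_div, abs_of_pos hn0, sub_div, div_self hn0.ne']
    rw [h4, h5, div_div, mul_comm ε]
    gcongr
  have h6 : (1 / 2 : ℝ) ^ m ≤ 1 / 4 :=
    (pow_le_pow_of_le_one (by norm_num) (by norm_num) hnm).trans hn2.le
  have h7 : ENNReal.ofReal (1 / 2) ≤ 1 - (ENNReal.ofReal (((m - d + 1 : ℕ) : ℝ) / (ε * m))
      + ENNReal.ofReal ((1 / 2) ^ m)) := by
    rw [← ENNReal.ofReal_add (by positivity) (by positivity), ← ENNReal.ofReal_one,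
      ← ENNReal.ofReal_sub _ (by positivity)]
    exact ENNReal.ofReal_le_ofReal (by linarith)
  calc (B : ℝ≥0∞) = ENNReal.ofReal B := (ENNReal.ofReal_coe_nnreal).symm
    _ < ENNReal.ofReal (4 * ((B : ℝ) + 1) * (1 / 2)) := by
        have := B.coe_nonneg
        exact (ENNReal.ofReal_lt_ofReal_iff (by positivity)).2 (by linarith)
    _ = ENNReal.ofReal (4 * ((B : ℝ) + 1)) * ENNReal.ofReal (1 / 2) :=
        ENNReal.ofReal_mul (by positivity)
    _ ≤ _ := by rw [hεR, hRr]; gcongr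

theorem lemma1 (c_m c_M : ℝ) (hc : 0 < c_m) :
    -- wide-matrix regime: `K` depends only on `c_m, c_M, γ, r`, and `K'` also on `p`
    (∀ γ r : ℝ, 1 < γ → 0 ≤ r →
      ∃ K : ℝ, 0 < K ∧
        ∀ p : ℕ → ℕ, (∀ n, 1 ≤ n → 1 ≤ p n) →
          Tendsto (fun n : ℕ => (p n : ℝ) / (n : ℝ)) atTop (𝓝 γ) →
          ∃ K' : ℝ, 0 < K' ∧
            ∀ (Ω : ℕ → Type*) [∀ n, MeasurableSpace (Ω n)] (P : ∀ n, Measure (Ω n))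
              (S : ∀ n, Matrix (Fin (p n)) (Fin (p n)) ℝ)
              (X : ∀ n, Ω n → Matrix (Fin n) (Fin (p n)) ℝ),
              IsGaussianDesign c_m c_M p P S X →
                (∀ᶠ n in atTop, condMoment (X n) (P n) r ≤ ENNReal.ofReal K) ∧
                (∀ n, 1 ≤ n → r < |(p n : ℝ) - (n : ℝ)| + 1 →
                  condMoment (X n) (P n) r ≤ ENNReal.ofReal K')) ∧
    -- critical regime
    (∀ p : ℕ → ℕ, (∀ n, 1 ≤ n → 1 ≤ p n) →
      Tendsto (fun n : ℕ => (p n : ℝ) / (n : ℝ)) atTop (𝓝 1) →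
      ∀ (Ω : ℕ → Type*) [∀ n, MeasurableSpace (Ω n)] (P : ∀ n, Measure (Ω n))
        (S : ∀ n, Matrix (Fin (p n)) (Fin (p n)) ℝ)
        (X : ∀ n, Ω n → Matrix (Fin n) (Fin (p n)) ℝ),
        IsGaussianDesign c_m c_M p P S X →
          ∀ r : ℝ, 0 < r →
            Tendsto (fun n : ℕ => condMoment (X n) (P n) r) atTop (𝓝 ∞)) := by
  refine ⟨fun γ r hγ hr => ?_, fun p hp hlim Ω _ P S X hX r hr => ?_⟩
  · rcases hr.eq_or_lt' with rfl | hr0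
    · have h1 : ∀ (p : ℕ → ℕ) (Ω : ℕ → Type _) [∀ n, MeasurableSpace (Ω n)]
          (P : ∀ n, Measure (Ω n)) (S : ∀ n, Matrix (Fin (p n)) (Fin (p n)) ℝ)
          (X : ∀ n, Ω n → Matrix (Fin n) (Fin (p n)) ℝ), IsGaussianDesign c_m c_M p P S X →
          ∀ n, 1 ≤ n → condMoment (X n) (P n) 0 ≤ ENNReal.ofReal 1 := by
        intro p Ω _ P S X hX n hn
        have := hX.isProbabilityMeasure n hn
        simp [condMoment]
      refine ⟨1, one_pos, fun p _ _ => ⟨1, one_pos, fun Ω _ P S X hX => ⟨?_, fun n hn _ =>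
        h1 p Ω P S X hX n hn⟩⟩⟩
      filter_upwards [eventually_ge_atTop 1] with n hn using h1 p Ω P S X hX n hn
    obtain ⟨K, hK0, hK⟩ := exists_lintegral_condNumber_rpow_le_uniform
      (C := (γ + 1) / (γ - 1)) (div_pos (by linarith) (sub_pos.2 hγ)) hr0
    set ρ : ℝ := (√c_M / √c_m) ^ r with hρ
    have hρ0 : 0 ≤ ρ := by positivity
    refine ⟨ρ * K + 1, by positivity, fun p hp hlim => ?_⟩
    obtain ⟨N, hN⟩ := eventually_atTop.1 (eventually_wide (r := r) hγ hlim)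
    have hlarge : ∀ n, 1 ≤ n → N ≤ n → ∫⁻ Z, condNumber (Matrix.of Z) ^ r
        ∂(stdGaussianMatrix (max n (p n)) (min n (p n))) ≤ ENNReal.ofReal K := by
      intro n hn hNn
      obtain ⟨h1, h2, h3, h4⟩ := hN n hNn
      rw [max_eq_right h1, min_eq_left h1]
      exact hK _ _ hn h1 h2 h3 h4
    -- finitely many `n` remain, and each has its own finite bound
    have hsmall : ∀ n, ∃ k : ℝ, 0 < k ∧ (1 ≤ n → r < |(p n : ℝ) - (n : ℝ)| + 1 →
        ∫⁻ Z, condNumber (Matrix.of Z) ^ r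
          ∂(stdGaussianMatrix (max n (p n)) (min n (p n))) ≤ ENNReal.ofReal k) := by
      intro n
      by_cases h : 1 ≤ n ∧ r < |(p n : ℝ) - (n : ℝ)| + 1
      · obtain ⟨k, hk0, hk⟩ := exists_lintegral_condNumber_rpow_le
          (le_min h.1 (hp n h.1)) (min_le_max) hr0 (by rw [← abs_sub_eq_max_sub_min]; exact h.2)
        exact ⟨k, hk0, fun _ _ => hk⟩
      · exact ⟨1, one_pos, fun h1 h2 => absurd ⟨h1, h2⟩ h⟩
    choose k hk0 hk using hsmall
    have hsum0 : 0 ≤ ∑ n ∈ Finset.range N, k n := Finset.sum_nonneg fun n _ => (hk0 n).le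
    refine ⟨ρ * (K + ∑ n ∈ Finset.range N, k n) + 1, by positivity, fun Ω _ P S X hX => ⟨?_, ?_⟩⟩
    · filter_upwards [eventually_ge_atTop 1, eventually_ge_atTop N] with n hn hNn
      have := hX.isProbabilityMeasure n hn
      exact condMoment_le_ofReal hn (hp n hn) (hX.rows n hn) hc (hX.eigenvalues n hn) hr
        (hlarge n hn hNn) (by linarith)
    · intro n hn hrn
      have := hX.isProbabilityMeasure n hn
      have hM : ∫⁻ Z, condNumber (Matrix.of Z) ^ r
          ∂(stdGaussianMatrix (max n (p n)) (min n (p n)))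
          ≤ ENNReal.ofReal (K + ∑ n ∈ Finset.range N, k n) := by
        rcases le_or_gt N n with h | h
        · exact (hlarge n hn h).trans (ENNReal.ofReal_le_ofReal (by linarith))
        · refine (hk n hn hrn).trans (ENNReal.ofReal_le_ofReal ?_)
          have := Finset.single_le_sum (fun i _ => (hk0 i).le) (Finset.mem_range.2 h)
          linarith
      exact condMoment_le_ofReal hn (hp n hn) (hX.rows n hn) hc (hX.eigenvalues n hn) hr
        hM (by linarith)
  · rw [ENNReal.tendsto_nhds_top_iff_nnreal]
    intro B
    set ρ : ℝ≥0∞ := ENNReal.ofReal (√c_M / √c_m) ^ r with hρ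
    have hρt : ρ * B ≠ ∞ := ENNReal.mul_ne_top
      (ENNReal.rpow_ne_top_of_nonneg hr.le ENNReal.ofReal_ne_top) ENNReal.coe_ne_top
    filter_upwards [(tendsto_lintegral_condNumber_rpow hp hlim hr).eventually_const_lt
      (lt_top_iff_ne_top.2 hρt), eventually_ge_atTop 1] with n h1 hn
    have := hX.isProbabilityMeasure n hn
    have h2 := h1.trans_le (le_mul_condMoment hn (hp n hn) (hX.rows n hn) hc
      (hX.eigenvalues n hn) hr.le)
    exact lt_of_mul_lt_mul_left h2 zero_le
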